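/- Let $T>0$, let $\mathbf W$ be a $d$-dimensional Brownian motion on a probability space, and let $n$ range over $\{0,1,2,\dots\}\cup\{\infty\}$. For every $n$ let $\mu_n:\mathbb R_+\to\mathbb R$ and $\sigma_n:\mathbb R_+\to\mathbb R^d$ be continuous (deterministic) functions such that, for some constants $\kappa,K>0$ not depending on $n$, $$\kappa\le\|\sigma_n(t)\|\le K,\qquad |\mu_n(t)|\le K\qquad(t\ge 0),$$ and let $X^n$ be a process with $$X^n_t=X^n_0+\int_0^t\mu_n(s)\,ds+\int_0^t\sigma_n(s)^\top d\mathbf W_s\quad\text{for all } t\ge0,\ \text{almost surely},$$ where the initial value $X^n_0$ is a constant or, more generally, a real random variable independent of $\mathbf W$. Let $\gamma_n,\Gamma_n:[0,T]\to\mathbb R$ be functions ("boundaries"), and put, with $\inf\emptyset=\infty$, $$\tau^n_\gamma:=\inf\{t\ge0:\gamma_n(t)-X^n_t\ge0\}\wedge T,\qquad \tau^n_\Gamma:=\inf\{t\ge0:X^n_t-\Gamma_n(t)\ge0\}\wedge T .$$ Suppose that (i) as $n\to\infty$, $\gamma_n\to\gamma_\infty$ and $\Gamma_n\to\Gamma_\infty$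 locally uniformly on $[0,T)$; (ii) as $n\to\infty$, $X^n_0\to X^\infty_0$ in probability, and $\mu_n(t)\to\mu_\infty(t)$ and $\sigma_n(t)\to\sigma_\infty(t)$ for every $t\in[0,T)$; (iii) either all $\gamma_n$ ($n\le\infty$) are nondecreasing and continuous on $[0,T)$, or the family $(\gamma_n)_{n\le\infty}$ is uniformly locally Lipschitz on $[0,T)$, that is, for every $S\in[0,T)$ there is a constant $L$ with $|\gamma_n(t)-\gamma_n(s)|\le L|t-s|$ for all $s,t\in[0,S]$ and all $n\le\infty$; (iv) either all $\Gamma_n$ ($n\le\infty$) are nonincreasing and continuous on $[0,T)$, or the family $(\Gamma_n)_{n\le\infty}$ is uniformly locally Lipschitz on $[0,T)$. Then $\tau^n_\gamma\to\tau^\infty_\gamma$ and $\tau^n_\Gamma\to\tau^\infty_\Gamma$ in probability as $n\to\infty$. -/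

import Mathlib

open MeasureTheory ProbabilityTheory Filter Topology
open scoped NNReal ENNReal RealInnerProductSpace

/-- A `d`-dimensional standard Brownian motion: the coordinates are independent one-dimensional
standard Brownian motions (started at `0`, almost surely continuous). -/
structure IsBrownianMotion {Ω : Type*} [MeasurableSpace Ω] {d : ℕ}
    (W : ℝ≥0 → Ω → EuclideanSpace ℝ (Fin d)) (P : Measure Ω) : Prop where
  coord : ∀ i : Fin d, IsBrownianReal (fun t ω => W t ω i) P
  indep : iIndepFun (fun (i : Fin d) (ω : Ω) (t : ℝ≥0) => W t ω i) P

/-- A deterministic `ℝᵈ`-valued step function on `[0, ∞)`, with value `val j` on the interval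
`(time j, time (j + 1)]` for `j < size` and value `0` elsewhere. -/
structure StepFunction (d : ℕ) where
  size : ℕ
  time : ℕ → ℝ≥0
  mono : Monotone time
  val : ℕ → EuclideanSpace ℝ (Fin d)

namespace StepFunction

/-- The value of the step function at time `s`. -/
noncomputable def eval {d : ℕ} (φ : StepFunction d) (s : ℝ≥0) : EuclideanSpace ℝ (Fin d) :=
  ∑ j ∈ Finset.range φ.size,
    (Set.Ioc (φ.time j) (φ.time (j + 1))).indicator (fun _ => φ.val j) s

/-- The elementary stochastic integral `∫₀ᵗ φ(s)ᵀ dW_s` of a step function. -/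
noncomputable def integral {Ω : Type*} {d : ℕ} (φ : StepFunction d)
    (W : ℝ≥0 → Ω → EuclideanSpace ℝ (Fin d)) (t : ℝ≥0) (ω : Ω) : ℝ :=
  ∑ j ∈ Finset.range φ.size,
    ⟪φ.val j, W (min (φ.time (j + 1)) t) ω - W (min (φ.time j) t) ω⟫

end StepFunction

/-- `M` is the stochastic integral process `M_t = ∫₀ᵗ σ(s)ᵀ dW_s` of the deterministic
integrand `σ`: it has almost surely continuous paths, and for each `t` the random variable `M_t`
is the limit in `L²(P)` of the elementary integrals of step functions that converge to `σ` in
`L²([0, t])`. (By the Itô isometry this limit does not depend on the approximating sequence.) -/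
structure IsStochasticIntegral {Ω : Type*} [MeasurableSpace Ω] {d : ℕ}
    (W : ℝ≥0 → Ω → EuclideanSpace ℝ (Fin d)) (σ : ℝ≥0 → EuclideanSpace ℝ (Fin d))
    (M : ℝ≥0 → Ω → ℝ) (P : Measure Ω) : Prop where
  cont : ∀ᵐ ω ∂P, Continuous (fun t => M t ω)
  memLp : ∀ t, MemLp (M t) 2 P
  approx : ∀ t : ℝ≥0, ∃ φ : ℕ → StepFunction d,
    Tendsto (fun m => ∫⁻ s in Set.Ioc (0 : ℝ) t,
      ‖(φ m).eval s.toNNReal - σ s.toNNReal‖ₑ ^ 2) atTop (𝓝 0) ∧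
    Tendsto (fun m => eLpNorm (fun ω => M t ω - (φ m).integral W t ω) 2 P) atTop (𝓝 0)

/-- `X_t = X_0 + ∫₀ᵗ μ(s) ds + ∫₀ᵗ σ(s)ᵀ dW_s` for all `t ≥ 0`, almost surely, with deterministic
coefficients `μ`, `σ` and an initial value `X_0` that is independent of `W` (for instance a
constant). -/
structure IsSolution {Ω : Type*} [MeasurableSpace Ω] {d : ℕ}
    (W : ℝ≥0 → Ω → EuclideanSpace ℝ (Fin d)) (μ : ℝ≥0 → ℝ)
    (σ : ℝ≥0 → EuclideanSpace ℝ (Fin d)) (X : ℝ≥0 → Ω → ℝ) (P : Measure Ω) : Prop where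
  aemeasurable_zero : AEMeasurable (X 0) P
  indep_zero : IndepFun (X 0) (fun (ω : Ω) (t : ℝ≥0) => W t ω) P
  eq_integral : ∃ M : ℝ≥0 → Ω → ℝ, IsStochasticIntegral W σ M P ∧
    ∀ᵐ ω ∂P, ∀ t : ℝ≥0,
      X t ω = X 0 ω + (∫ s in (0 : ℝ)..t, μ s.toNNReal) + M t ω

/-- The functions `γ n`, `n ∈ ℕ ∪ {∞}`, are uniformly locally Lipschitz on `[0, T)`: on each
`[0, S]` with `S < T` they share a Lipschitz constant. -/
def UniformlyLocallyLipschitz (γ : ℕ∞ → ℝ≥0 → ℝ) (T : ℝ≥0) : Prop :=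
  ∀ S < T, ∃ L : ℝ≥0, ∀ n, LipschitzOnWith L (γ n) (Set.Icc 0 S)

/-- `inf {t ≥ 0 : γ(t) - X_t ≥ 0} ∧ T`. -/
noncomputable def lowerHittingTime {Ω : Type*} (γ : ℝ≥0 → ℝ) (X : ℝ≥0 → Ω → ℝ) (T : ℝ≥0) :
    Ω → ℝ≥0 :=
  hittingBtwn (fun t ω => γ t - X t ω) (Set.Ici 0) 0 T

/-- `inf {t ≥ 0 : X_t - Γ(t) ≥ 0} ∧ T`. -/
noncomputable def upperHittingTime {Ω : Type*} (Γ : ℝ≥0 → ℝ) (X : ℝ≥0 → Ω → ℝ) (T : ℝ≥0) :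
    Ω → ℝ≥0 :=
  hittingBtwn (fun t ω => X t ω - Γ t) (Set.Ici 0) 0 T

/-!
The hitting time of a boundary `γ` is a continuous functional, for uniform convergence of paths and
locally uniform convergence of boundaries, at every path that goes strictly below `γ` immediately
after hitting it (`tendsto_lowerHittingTime`). Hence two facts suffice: the solutions converge
uniformly on `[0, T]` in probability, and almost every path of the limiting solution has this
crossing property. Passing to almost surely convergent subsequences then gives the claim for lower
boundaries, and the upper ones follow by changing all signs.

Both facts rest on the description of `∫ σ dW` as a Wiener integral: the pairs of an integrand
`f ∈ L²` and its integral form the closed span of the pairs `(𝟙_{(0, u]} eᵢ, Wⁱ_u)`. On this closed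
subspace the Itô isometry holds, all integrals are centered Gaussian, integrals of orthogonal
families of integrands are independent, and each integral is a functional of the path of `W`, hence
independent of the initial value.

* Uniform convergence (`tendsto_measure_exists_lt_abs_sub`): the difference of the stochastic
  integrals has variance `∫₀ᵀ ‖σₙ - σ‖²`, which tends to `0` by dominated convergence, and Doob's
  maximal inequality (`measure_exists_lt_abs_le`) controls its supremum.
* Crossing (`IsSolution.ae_exists_lt`): a path that hits `γ` without crossing it touches `γ` from
  above. Contact at a positive time is excluded without the strong Markov property: for `δ > 0` the
  infimum of `X - γ` over `[δ, q]` is the sum of the Gaussian variable `M_δ` and an independent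
  variable, so it has no atom at `0` (`measure_inf_eq_zero`). Contact at time `0` is excluded as
  `γ` decreases at most linearly there, whereas `M` falls below every line `t ↦ -c t` at arbitrarily
  small times (`ae_exists_lt_neg_mul`), by the second Borel–Cantelli lemma.
-/

/-! ### Wiener integrals of deterministic functions -/

section WienerIntegral

variable {Ω : Type*} [MeasurableSpace Ω] {P : Measure Ω} {d : ℕ}
  {W : ℝ≥0 → Ω → EuclideanSpace ℝ (Fin d)}

/-- The graph of the elementary Wiener integral: the pairs of an indicator `𝟙_{(0, u]} eᵢ` and the
coordinate `Wⁱ_u`. -/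
def elementaryWienerPairs (W : ℝ≥0 → Ω → EuclideanSpace ℝ (Fin d)) (P : Measure Ω) :
    Set (Lp (EuclideanSpace ℝ (Fin d)) 2 (volume : Measure ℝ) × Lp ℝ 2 P) :=
  {x | ∃ (u : ℝ≥0) (i : Fin d),
    x.1 =ᵐ[volume] (Set.Ioc (0 : ℝ) u).indicator (fun _ => EuclideanSpace.single i (1 : ℝ)) ∧
    x.2 =ᵐ[P] fun ω => W u ω i}

/-- The graph of the Wiener integral `f ↦ ∫ f dW`, as the closed linear span in `L² × L²` of the
graph of the elementary integral. -/
noncomputable def wienerGraph (W : ℝ≥0 → Ω → EuclideanSpace ℝ (Fin d)) (P : Measure Ω) :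
    Submodule ℝ (Lp (EuclideanSpace ℝ (Fin d)) 2 (volume : Measure ℝ) × Lp ℝ 2 P) :=
  (Submodule.span ℝ (elementaryWienerPairs W P)).topologicalClosure

/-- `Z` is the Wiener integral `∫ f(s)ᵀ dW_s` of the square-integrable function `f : ℝ → ℝᵈ`. Only
the values of `f` on `(0, ∞)` are integrated; `f` vanishes elsewhere. -/
def IsWienerIntegral (W : ℝ≥0 → Ω → EuclideanSpace ℝ (Fin d)) (P : Measure Ω)
    (f : ℝ → EuclideanSpace ℝ (Fin d)) (Z : Ω → ℝ) : Prop :=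
  ∃ x ∈ wienerGraph W P, x.1 =ᵐ[volume] f ∧ x.2 =ᵐ[P] Z

lemma IsBrownianMotion.covariance (hW : IsBrownianMotion W P) [IsProbabilityMeasure P]
    (u v : ℝ≥0) (i j : Fin d) :
    ∫ ω, W u ω i * W v ω j ∂P = if i = j then ((min u v : ℝ≥0) : ℝ) else 0 := by
  have hint (i : Fin d) (u : ℝ≥0) : MemLp (fun ω => W u ω i) 2 P :=
    ((hW.coord i).hasLaw_eval u).hasGaussianLaw.memLp_two
  have h0 (i : Fin d) (u : ℝ≥0) : ∫ ω, W u ω i ∂P = 0 := (hW.coord i).integral_eval u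
  split_ifs with hij
  · subst hij
    have := (hW.coord i).covariance_eval u v
    rw [covariance_eq_sub (hint i u) (hint i v), h0, zero_mul, sub_zero] at this
    simpa using this
  · have hI : IndepFun (fun ω => W u ω i) (fun ω => W v ω j) P :=
      (hW.indep.indepFun hij).comp (measurable_pi_apply u) (measurable_pi_apply v)
    have := hI.integral_mul_eq_mul_integral (hint i u).1 (hint j v).1
    simpa [h0] using this

/-- All coordinates of `W` at all times are jointly Gaussian. -/
lemma isGaussianProcess_coord (hW : IsBrownianMotion W P) [IsProbabilityMeasure P] :
    IsGaussianProcess (fun (p : ℝ≥0 × Fin d) ω => W p.1 ω p.2) P where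
  hasGaussianLaw I := by
    classical
    let J := I.image Prod.fst
    have h1 (i : Fin d) : HasGaussianLaw (fun ω => J.restrict (fun t => W t ω i)) P :=
      ((hW.coord i).hasLaw J).hasGaussianLaw
    have h2 : iIndepFun (fun (i : Fin d) ω => J.restrict (fun t => W t ω i)) P :=
      hW.indep.comp (fun _ => J.restrict) (fun _ => by fun_prop)
    have h3 := h2.hasGaussianLaw h1
    let L : (Fin d → J → ℝ) →L[ℝ] (I → ℝ) :=
      ContinuousLinearMap.pi fun p =>
        (ContinuousLinearMap.proj (R := ℝ) (φ := fun _ : J => ℝ)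
          (⟨p.1.1, Finset.mem_image_of_mem _ p.2⟩ : J)).comp
          (ContinuousLinearMap.proj (R := ℝ) (φ := fun _ : Fin d => J → ℝ) p.1.2)
    exact h3.map L

/-- The Itô isometry, in polarised form. -/
lemma wienerGraph_inner_eq (hW : IsBrownianMotion W P) [IsProbabilityMeasure P]
    {x y : Lp (EuclideanSpace ℝ (Fin d)) 2 (volume : Measure ℝ) × Lp ℝ 2 P}
    (hx : x ∈ wienerGraph W P) (hy : y ∈ wienerGraph W P) :
    ⟪x.1, y.1⟫ = ⟪x.2, y.2⟫ := by
  -- the generators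
  have hgen : ∀ x ∈ elementaryWienerPairs W P, ∀ y ∈ elementaryWienerPairs W P,
      ⟪x.1, y.1⟫ = ⟪x.2, y.2⟫ := by
    rintro x ⟨u, i, hx1, hx2⟩ y ⟨v, j, hy1, hy2⟩
    rw [L2.inner_def, L2.inner_def]
    have e2 : ∫ ω, ⟪x.2 ω, y.2 ω⟫ ∂P = ∫ ω, W u ω i * W v ω j ∂P := by
      refine integral_congr_ae ?_
      filter_upwards [hx2, hy2] with ω h1 h2
      rw [h1, h2]
      simp [mul_comm]
    have e1 : ∫ s, ⟪x.1 s, y.1 s⟫ = ∫ s, (Set.Ioc (0 : ℝ) (min u v : ℝ≥0)).indicator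
        (fun _ => if i = j then (1 : ℝ) else 0) s := by
      refine integral_congr_ae ?_
      filter_upwards [hx1, hy1] with s h1 h2
      rw [h1, h2]
      rw [Set.indicator_apply, Set.indicator_apply, Set.indicator_apply]
      have hmem : s ∈ Set.Ioc (0 : ℝ) (min u v : ℝ≥0) ↔
          s ∈ Set.Ioc (0 : ℝ) u ∧ s ∈ Set.Ioc (0 : ℝ) v := by
        simp only [Set.mem_Ioc, NNReal.coe_min, le_min_iff]
        tauto
      simp only [hmem]
      by_cases hu : s ∈ Set.Ioc (0 : ℝ) u <;> by_cases hv : s ∈ Set.Ioc (0 : ℝ) v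
      · rw [if_pos hu, if_pos hv, if_pos ⟨hu, hv⟩]
        simp [EuclideanSpace.inner_single_left]
      all_goals simp [hu, hv]
    rw [e1, e2, hW.covariance, integral_indicator measurableSet_Ioc]
    split_ifs <;> simp
  have hspan : ∀ x ∈ Submodule.span ℝ (elementaryWienerPairs W P),
      ∀ y ∈ Submodule.span ℝ (elementaryWienerPairs W P), ⟪x.1, y.1⟫ = ⟪x.2, y.2⟫ := by
    intro x hx y hy
    induction hx using Submodule.span_induction with
    | zero => simp
    | add a b _ _ ha hb => simp only [Prod.fst_add, Prod.snd_add, inner_add_left, ha, hb]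
    | smul c a _ ha => simp only [Prod.smul_fst, Prod.smul_snd, real_inner_smul_left, ha]
    | mem x hx =>
      induction hy using Submodule.span_induction with
      | zero => simp
      | add a b _ _ ha hb => simp only [Prod.fst_add, Prod.snd_add, inner_add_right, ha, hb]
      | smul c a _ ha => simp only [Prod.smul_fst, Prod.smul_snd, real_inner_smul_right, ha]
      | mem y hy => exact hgen x hx y hy
  have h1 : ∀ x ∈ Submodule.span ℝ (elementaryWienerPairs W P), ⟪x.1, y.1⟫ = ⟪x.2, y.2⟫ := by
    intro x hx
    have hcl : IsClosed {y : Lp (EuclideanSpace ℝ (Fin d)) 2 (volume : Measure ℝ) × Lp ℝ 2 P |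
        ⟪x.1, y.1⟫ = ⟪x.2, y.2⟫} := isClosed_eq (by fun_prop) (by fun_prop)
    exact closure_minimal (fun y hy => hspan x hx y hy) hcl hy
  have hcl : IsClosed {x : Lp (EuclideanSpace ℝ (Fin d)) 2 (volume : Measure ℝ) × Lp ℝ 2 P |
      ⟪x.1, y.1⟫ = ⟪x.2, y.2⟫} := isClosed_eq (by fun_prop) (by fun_prop)
  exact closure_minimal (fun x hx => h1 x hx) hcl hx

/-- The elements of the algebraic span are finite linear combinations of coordinates of `W`. -/
lemma exists_sum_of_mem_span
    {x : Lp (EuclideanSpace ℝ (Fin d)) 2 (volume : Measure ℝ) × Lp ℝ 2 P}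
    (hx : x ∈ Submodule.span ℝ (elementaryWienerPairs W P)) :
    ∃ c : (ℝ≥0 × Fin d) →₀ ℝ, x.2 =ᵐ[P] fun ω => c.sum fun p a => a * W p.1 ω p.2 := by
  induction hx using Submodule.span_induction with
  | zero =>
    refine ⟨0, ?_⟩
    filter_upwards [Lp.coeFn_zero ℝ 2 P] with ω h
    rw [Prod.snd_zero, h]
    simp
  | mem x hx =>
    obtain ⟨u, i, -, h⟩ := hx
    refine ⟨Finsupp.single (u, i) 1, ?_⟩
    filter_upwards [h] with ω h
    simp [h]
  | add a b _ _ ha hb =>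
    obtain ⟨c, hc⟩ := ha
    obtain ⟨c', hc'⟩ := hb
    refine ⟨c + c', ?_⟩
    filter_upwards [hc, hc', Lp.coeFn_add a.2 b.2] with ω h h' h''
    rw [Prod.snd_add, h'', Pi.add_apply, h, h', Finsupp.sum_add_index']
    · simp
    · intros; ring
  | smul r a _ ha =>
    obtain ⟨c, hc⟩ := ha
    refine ⟨r • c, ?_⟩
    filter_upwards [hc, Lp.coeFn_smul r a.2] with ω h h''
    rw [Prod.smul_snd, h'', Pi.smul_apply, h, Finsupp.sum_smul_index' (by simp), smul_eq_mul,
      Finsupp.mul_sum]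
    simp [mul_assoc]

/-- The Wiener integrals are functionals of the path of `W`. -/
lemma exists_measurable_of_mem_wienerGraph
    {x : Lp (EuclideanSpace ℝ (Fin d)) 2 (volume : Measure ℝ) × Lp ℝ 2 P}
    (hx : x ∈ wienerGraph W P) :
    ∃ F : (ℝ≥0 → EuclideanSpace ℝ (Fin d)) → ℝ, Measurable F ∧
      x.2 =ᵐ[P] fun ω => F (fun t => W t ω) := by
  obtain ⟨y, hy, hlim⟩ := mem_closure_iff_seq_limit.1 hx
  choose c hc using fun n => exists_sum_of_mem_span (hy n)
  obtain ⟨ns, -, hns⟩ := (tendstoInMeasure_of_tendsto_Lp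
    ((continuous_snd.tendsto x).comp hlim)).exists_seq_tendsto_ae
  refine ⟨fun w => limsup (fun k => (c (ns k)).sum fun p a => a * w p.1 p.2) atTop,
    Measurable.limsup fun k => ?_, ?_⟩
  · unfold Finsupp.sum
    fun_prop
  · filter_upwards [hns, ae_all_iff.2 hc] with ω h h'
    refine (Tendsto.limsup_eq ?_).symm
    simpa [h'] using h

/-- The Wiener integrals are centered Gaussian variables. -/
lemma hasLaw_of_mem_wienerGraph (hW : IsBrownianMotion W P) [IsProbabilityMeasure P]
    {x : Lp (EuclideanSpace ℝ (Fin d)) 2 (volume : Measure ℝ) × Lp ℝ 2 P}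
    (hx : x ∈ wienerGraph W P) :
    HasLaw x.2 (gaussianReal 0 (‖x.2‖₊ ^ 2)) P := by
  have hspan : ∀ x ∈ Submodule.span ℝ (elementaryWienerPairs W P),
      HasLaw x.2 (gaussianReal 0 (‖x.2‖₊ ^ 2)) P := by
    intro x hx
    obtain ⟨c, hc⟩ := exists_sum_of_mem_span hx
    have hG : HasGaussianLaw x.2 P := by
      have := ((isGaussianProcess_coord hW).smul fun p => c p).hasGaussianLaw_fun_sum
        (I := c.support)
      exact this.congr hc.symm
    have h0 : ∫ ω, x.2 ω ∂P = 0 := by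
      rw [integral_congr_ae hc]
      unfold Finsupp.sum
      rw [integral_finsetSum]
      · refine Finset.sum_eq_zero fun p _ => ?_
        rw [integral_const_mul, (hW.coord p.2).integral_eval p.1, mul_zero]
      · exact fun p _ => ((hW.coord p.2).integrable_eval p.1).const_mul _
    refine ⟨(Lp.aestronglyMeasurable x.2).aemeasurable, ?_⟩
    rw [hG.map_eq_gaussianReal, h0, variance_of_integral_eq_zero hG.aemeasurable h0]
    congr 1
    have : ‖x.2‖ ^ 2 = ∫ ω, x.2 ω ^ 2 ∂P := by
      rw [← real_inner_self_eq_norm_sq, L2.inner_def]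
      exact integral_congr_ae (ae_of_all _ fun ω => by simp [sq])
    rw [← this]
    ext
    simp
  obtain ⟨y, hy, hlim⟩ := mem_closure_iff_seq_limit.1 hx
  have hlim2 := (continuous_snd.tendsto x).comp hlim
  have hd := (tendstoInMeasure_of_tendsto_Lp hlim2).tendstoInDistribution
    fun n => (Lp.aestronglyMeasurable (y n).2).aemeasurable
  refine ⟨(Lp.aestronglyMeasurable x.2).aemeasurable, ?_⟩
  have : IsProbabilityMeasure (P.map x.2) :=
    Measure.isProbabilityMeasure_map (Lp.aestronglyMeasurable x.2).aemeasurable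
  refine Measure.ext_of_charFun (funext fun t => ?_)
  have h1 := (ProbabilityMeasure.tendsto_iff_tendsto_charFun.1 hd.tendsto) t
  have h2 : Tendsto (fun n => charFun (P.map (y n).2) t) atTop
      (𝓝 (charFun (gaussianReal 0 (‖x.2‖₊ ^ 2)) t)) := by
    simp_rw [(hspan _ (hy _)).map_eq, charFun_gaussianReal]
    have h3 : Tendsto (fun n => ((‖(y n).2‖₊ : ℝ) : ℂ)) atTop (𝓝 ((‖x.2‖₊ : ℝ) : ℂ)) :=
      (Complex.continuous_ofReal.tendsto _).comp
        ((continuous_norm.tendsto _).comp hlim2)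
    have h4 : Continuous fun z : ℂ =>
      Complex.exp (t * ((0 : ℝ) : ℂ) * Complex.I - z ^ 2 * t ^ 2 / 2) := by fun_prop
    simpa [Function.comp_def] using (h4.tendsto _).comp h3
  exact tendsto_nhds_unique h1 h2

end WienerIntegral

namespace IsWienerIntegral

variable {Ω : Type*} [MeasurableSpace Ω] {P : Measure Ω} {d : ℕ}
  {W : ℝ≥0 → Ω → EuclideanSpace ℝ (Fin d)}
  {f g : ℝ → EuclideanSpace ℝ (Fin d)} {Y Z : Ω → ℝ}

lemma memLp_left (h : IsWienerIntegral W P f Z) : MemLp f 2 := by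
  obtain ⟨x, -, h1, -⟩ := h
  exact (memLp_congr_ae h1).1 (Lp.memLp x.1)

lemma memLp (h : IsWienerIntegral W P f Z) : MemLp Z 2 P := by
  obtain ⟨x, -, -, h2⟩ := h
  exact (memLp_congr_ae h2).1 (Lp.memLp x.2)

lemma congr (h : IsWienerIntegral W P f Z) (hf : f =ᵐ[volume] g) (hZ : Z =ᵐ[P] Y) :
    IsWienerIntegral W P g Y := by
  obtain ⟨x, hx, h1, h2⟩ := h
  exact ⟨x, hx, h1.trans hf, h2.trans hZ⟩

lemma zero : IsWienerIntegral W P 0 0 :=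
  ⟨0, Submodule.zero_mem _, Lp.coeFn_zero _ 2 _, Lp.coeFn_zero _ 2 _⟩

lemma add (hf : IsWienerIntegral W P f Z) (hg : IsWienerIntegral W P g Y) :
    IsWienerIntegral W P (f + g) (Z + Y) := by
  obtain ⟨x, hx, h1, h2⟩ := hf
  obtain ⟨y, hy, h3, h4⟩ := hg
  exact ⟨x + y, Submodule.add_mem _ hx hy, (Lp.coeFn_add x.1 y.1).trans (h1.add h3),
    (Lp.coeFn_add x.2 y.2).trans (h2.add h4)⟩

lemma const_smul (hf : IsWienerIntegral W P f Z) (c : ℝ) :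
    IsWienerIntegral W P (c • f) (c • Z) := by
  obtain ⟨x, hx, h1, h2⟩ := hf
  exact ⟨c • x, Submodule.smul_mem _ c hx, (Lp.coeFn_smul c x.1).trans (h1.const_smul c),
    (Lp.coeFn_smul c x.2).trans (h2.const_smul c)⟩

lemma sub (hf : IsWienerIntegral W P f Z) (hg : IsWienerIntegral W P g Y) :
    IsWienerIntegral W P (f - g) (Z - Y) := by
  simpa [sub_eq_add_neg] using hf.add (hg.const_smul (-1))

lemma sum {ι : Type*} {s : Finset ι} {f : ι → ℝ → EuclideanSpace ℝ (Fin d)} {Z : ι → Ω → ℝ}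
    (h : ∀ i ∈ s, IsWienerIntegral W P (f i) (Z i)) :
    IsWienerIntegral W P (∑ i ∈ s, f i) (∑ i ∈ s, Z i) := by
  classical
  induction s using Finset.induction_on with
  | empty => simpa using zero
  | insert a s ha ih =>
    rw [Finset.sum_insert ha, Finset.sum_insert ha]
    exact (h a (Finset.mem_insert_self a s)).add
      (ih fun i hi => h i (Finset.mem_insert_of_mem hi))

lemma of_tendsto {f' : ℕ → ℝ → EuclideanSpace ℝ (Fin d)} {Z' : ℕ → Ω → ℝ}
    (h : ∀ m, IsWienerIntegral W P (f' m) (Z' m)) (hf : MemLp f 2) (hZ : MemLp Z 2 P)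
    (hf' : Tendsto (fun m => eLpNorm (f' m - f) 2) atTop (𝓝 0))
    (hZ' : Tendsto (fun m => eLpNorm (Z' m - Z) 2 P) atTop (𝓝 0)) :
    IsWienerIntegral W P f Z := by
  refine ⟨(hf.toLp f, hZ.toLp Z), ?_, hf.coeFn_toLp, hZ.coeFn_toLp⟩
  have hmem (m : ℕ) : ((h m).memLp_left.toLp (f' m), (h m).memLp.toLp (Z' m)) ∈
      wienerGraph W P := by
    obtain ⟨x, hx, h1, h2⟩ := h m
    convert! hx
    · exact Lp.ext ((MemLp.coeFn_toLp _).trans h1.symm)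
    · exact Lp.ext ((MemLp.coeFn_toLp _).trans h2.symm)
  have hcl : IsClosed (wienerGraph W P : Set (Lp (EuclideanSpace ℝ (Fin d)) 2
    (volume : Measure ℝ) × Lp ℝ 2 P)) := Submodule.isClosed_topologicalClosure _
  refine hcl.mem_of_tendsto (b := atTop)
    (Tendsto.prodMk_nhds ?_ ?_) (Eventually.of_forall hmem)
  · exact (Lp.tendsto_Lp_iff_tendsto_eLpNorm'' _ (fun m => (h m).memLp_left) _ hf).2 hf'
  · exact (Lp.tendsto_Lp_iff_tendsto_eLpNorm'' _ (fun m => (h m).memLp) _ hZ).2 hZ'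

/-- A Wiener integral is a functional of the path of `W`. -/
lemma exists_measurable (h : IsWienerIntegral W P f Z) :
    ∃ F : (ℝ≥0 → EuclideanSpace ℝ (Fin d)) → ℝ, Measurable F ∧
      Z =ᵐ[P] fun ω => F (fun t => W t ω) := by
  obtain ⟨x, hx, -, h2⟩ := h
  obtain ⟨F, hF, h3⟩ := exists_measurable_of_mem_wienerGraph hx
  exact ⟨F, hF, h2.symm.trans h3⟩

variable [IsProbabilityMeasure P]

/-- The **Itô isometry** for deterministic integrands. -/
lemma integral_mul (hW : IsBrownianMotion W P) (hf : IsWienerIntegral W P f Z)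
    (hg : IsWienerIntegral W P g Y) : ∫ ω, Z ω * Y ω ∂P = ∫ s, ⟪f s, g s⟫ := by
  obtain ⟨x, hx, h1, h2⟩ := hf
  obtain ⟨y, hy, h3, h4⟩ := hg
  have := wienerGraph_inner_eq hW hx hy
  rw [L2.inner_def, L2.inner_def] at this
  rw [integral_congr_ae (g := fun s => ⟪x.1 s, y.1 s⟫), this]
  · refine integral_congr_ae ?_
    filter_upwards [h2, h4] with ω h h'
    simp [h, h', mul_comm]
  · filter_upwards [h1, h3] with ω h h'
    simp [h, h']

lemma integral_sq (hW : IsBrownianMotion W P) (hf : IsWienerIntegral W P f Z) :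
    ∫ ω, Z ω ^ 2 ∂P = ∫ s, ‖f s‖ ^ 2 := by
  simpa [sq] using hf.integral_mul hW hf

lemma hasLaw (hW : IsBrownianMotion W P) (hf : IsWienerIntegral W P f Z) :
    HasLaw Z (gaussianReal 0 (∫ s, ‖f s‖ ^ 2).toNNReal) P := by
  rw [← hf.integral_sq hW]
  obtain ⟨x, hx, h1, h2⟩ := hf
  have h3 := (hasLaw_of_mem_wienerGraph hW hx).congr h2.symm
  convert! h3
  have : ‖x.2‖ ^ 2 = ∫ ω, Z ω ^ 2 ∂P := by
    rw [← real_inner_self_eq_norm_sq, L2.inner_def]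
    refine integral_congr_ae ?_
    filter_upwards [h2] with ω h
    simp [sq, h]
  rw [← this]
  ext
  simp

lemma integral_eq_zero (hW : IsBrownianMotion W P) (hf : IsWienerIntegral W P f Z) :
    ∫ ω, Z ω ∂P = 0 := by
  rw [(hf.hasLaw hW).integral_eq, integral_id_gaussianReal]

lemma covariance_eq (hW : IsBrownianMotion W P) (hf : IsWienerIntegral W P f Z)
    (hg : IsWienerIntegral W P g Y) : cov[Z, Y; P] = ∫ s, ⟪f s, g s⟫ := by
  rw [covariance_eq_sub hf.memLp hg.memLp, hf.integral_eq_zero hW, zero_mul, sub_zero,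
    ← hf.integral_mul hW hg]
  rfl

/-- Wiener integrals of a family of integrands form a Gaussian process. -/
lemma isGaussianProcess (hW : IsBrownianMotion W P) {ι : Type*}
    {f : ι → ℝ → EuclideanSpace ℝ (Fin d)} {Z : ι → Ω → ℝ}
    (h : ∀ i, IsWienerIntegral W P (f i) (Z i)) : IsGaussianProcess Z P where
  hasGaussianLaw I := by
    classical
    have hm : AEMeasurable (fun ω => I.restrict (Z · ω)) P :=
      aemeasurable_pi_lambda _ fun i => (h i).memLp.1.aemeasurable
    refine ⟨⟨fun L => ?_⟩⟩
    have hL : L ∘ (fun ω => I.restrict (Z · ω)) =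
        ∑ i : I, L (Pi.single i 1) • Z i := by
      ext ω
      have : I.restrict (Z · ω) = ∑ i : I, Z i ω • (Pi.single i 1 : I → ℝ) := by
        ext j
        simp [Finset.sum_apply, Pi.single_apply]
      simp only [Function.comp_apply]
      rw [this, map_sum]
      simp [mul_comm]
    have hG : HasGaussianLaw (L ∘ (fun ω => I.restrict (Z · ω))) P := by
      rw [hL]
      exact ((IsWienerIntegral.sum fun (i : I) _ =>
        (h i).const_smul (L (Pi.single i 1))).hasLaw hW).hasGaussianLaw
    rw [AEMeasurable.map_map_of_aemeasurable (by fun_prop) hm, hG.map_eq_gaussianReal,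
      integral_map hm (by fun_prop), variance_map (by fun_prop) hm]
    rfl

end IsWienerIntegral

section StochasticIntegral

variable {Ω : Type*} [MeasurableSpace Ω] {P : Measure Ω} {d : ℕ}
  {W : ℝ≥0 → Ω → EuclideanSpace ℝ (Fin d)}

lemma isWienerIntegral_coord (hW : IsBrownianMotion W P) [IsProbabilityMeasure P] (u : ℝ≥0)
    (i : Fin d) :
    IsWienerIntegral W P
      ((Set.Ioc (0 : ℝ) u).indicator fun _ => EuclideanSpace.single i (1 : ℝ))
      (fun ω => W u ω i) := by
  have h1 : MemLp ((Set.Ioc (0 : ℝ) u).indicator fun _ => EuclideanSpace.single i (1 : ℝ)) 2 :=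
    memLp_indicator_const 2 measurableSet_Ioc _ (Or.inr (by simp))
  have h2 : MemLp (fun ω => W u ω i) 2 P :=
    ((hW.coord i).hasLaw_eval u).hasGaussianLaw.memLp_two
  exact ⟨(h1.toLp _, h2.toLp _), Submodule.le_topologicalClosure _
    (Submodule.subset_span ⟨u, i, h1.coeFn_toLp, h2.coeFn_toLp⟩), h1.coeFn_toLp, h2.coeFn_toLp⟩

lemma isWienerIntegral_const (hW : IsBrownianMotion W P) [IsProbabilityMeasure P] (u : ℝ≥0)
    (a : EuclideanSpace ℝ (Fin d)) :
    IsWienerIntegral W P ((Set.Ioc (0 : ℝ) u).indicator fun _ => a) (fun ω => ⟪a, W u ω⟫) := by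
  refine (IsWienerIntegral.sum (s := Finset.univ) fun i _ =>
    (isWienerIntegral_coord hW u i).const_smul (a i)).congr
    (Eventually.of_forall fun s => ?_) (Eventually.of_forall fun ω => ?_)
  · by_cases hs : s ∈ Set.Ioc (0 : ℝ) u
    · ext j
      simp [Finset.sum_apply, hs, Pi.single_apply]
    · simp [Finset.sum_apply, hs]
  · simp [Finset.sum_apply, PiLp.inner_apply, mul_comm]

lemma StepFunction.isWienerIntegral (hW : IsBrownianMotion W P) [IsProbabilityMeasure P]
    (φ : StepFunction d) (t : ℝ≥0) :
    IsWienerIntegral W P ((Set.Ioc (0 : ℝ) t).indicator fun s => φ.eval s.toNNReal)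
      (φ.integral W t) := by
  refine (IsWienerIntegral.sum (s := Finset.range φ.size) fun j _ =>
    (isWienerIntegral_const hW (min (φ.time (j + 1)) t) (φ.val j)).sub
    (isWienerIntegral_const hW (min (φ.time j) t) (φ.val j))).congr
    (Eventually.of_forall fun s => ?_) (Eventually.of_forall fun ω => ?_)
  · simp only [StepFunction.eval, Finset.sum_apply, Pi.sub_apply]
    by_cases hs : s ∈ Set.Ioc (0 : ℝ) t
    · rw [Set.indicator_of_mem hs]
      refine Finset.sum_congr rfl fun j _ => ?_
      have hle : φ.time j ≤ φ.time (j + 1) := φ.mono (Nat.le_succ j)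
      have e (u : ℝ≥0) : s ∈ Set.Ioc (0 : ℝ) (min u t : ℝ≥0) ↔ s.toNNReal ≤ u := by
        rw [Real.toNNReal_le_iff_le_coe]
        simp [hs.1, hs.2]
      simp only [Set.indicator_apply, e, Set.mem_Ioc]
      by_cases h1 : s.toNNReal ≤ φ.time j
      · simp [h1, h1.trans hle]
      · simp [h1, not_le.1 h1]
    · rw [Set.indicator_of_notMem hs]
      refine Finset.sum_eq_zero fun j _ => ?_
      have e (u : ℝ≥0) : s ∉ Set.Ioc (0 : ℝ) (min u t : ℝ≥0) := fun h =>
        hs ⟨h.1, h.2.trans (by simp)⟩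
      rw [Set.indicator_of_notMem (e _), Set.indicator_of_notMem (e _), sub_zero]
  · simp [StepFunction.integral, Finset.sum_apply, inner_sub_right]

lemma memLp_indicator_Ioc {σ : ℝ≥0 → EuclideanSpace ℝ (Fin d)} (hσ : Continuous σ) (s t : ℝ) :
    MemLp ((Set.Ioc s t).indicator fun x : ℝ => σ x.toNNReal) 2 := by
  rw [memLp_indicator_iff_restrict measurableSet_Ioc]
  have hc : Continuous fun x : ℝ => σ x.toNNReal := by fun_prop
  obtain ⟨C, hC⟩ := (isCompact_Icc (a := s) (b := t)).exists_bound_of_continuousOn hc.continuousOn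
  refine MemLp.of_bound hc.aestronglyMeasurable C ?_
  filter_upwards [ae_restrict_mem measurableSet_Ioc] with x hx
  exact hC x (Set.Ioc_subset_Icc_self hx)

/-- The stochastic integral `∫₀ᵗ σ dW` is the Wiener integral of `𝟙_{(0, t]} σ`. -/
lemma IsStochasticIntegral.isWienerIntegral (hW : IsBrownianMotion W P) [IsProbabilityMeasure P]
    {σ : ℝ≥0 → EuclideanSpace ℝ (Fin d)} {M : ℝ≥0 → Ω → ℝ} (hσ : Continuous σ)
    (hM : IsStochasticIntegral W σ M P) (t : ℝ≥0) :
    IsWienerIntegral W P ((Set.Ioc (0 : ℝ) t).indicator fun s => σ s.toNNReal) (M t) := by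
  obtain ⟨φ, h1, h2⟩ := hM.approx t
  refine IsWienerIntegral.of_tendsto (fun m => (φ m).isWienerIntegral hW t)
    (memLp_indicator_Ioc hσ 0 t) (hM.memLp t) ?_ ?_
  · have h3 : Tendsto (fun x : ℝ≥0∞ => x ^ (1 / 2 : ℝ)) (𝓝 0) (𝓝 0) := by
      simpa using (ENNReal.continuous_rpow_const (y := (1 / 2 : ℝ))).tendsto 0
    refine (h3.comp h1).congr fun m => ?_
    rw [← Set.indicator_sub', eLpNorm_indicator_eq_eLpNorm_restrict measurableSet_Ioc,
      eLpNorm_eq_lintegral_rpow_enorm_toReal (by simp) (by simp)]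
    simp
  · refine h2.congr fun m => ?_
    rw [← eLpNorm_neg]
    congr 1
    ext ω
    simp

end StochasticIntegral

/-! ### Independence and the maximal inequality -/

section Independence

variable {Ω : Type*} [MeasurableSpace Ω] {P : Measure Ω} [IsProbabilityMeasure P] {d : ℕ}
  {W : ℝ≥0 → Ω → EuclideanSpace ℝ (Fin d)}

/-- Wiener integrals of two mutually orthogonal families of integrands are independent. -/
lemma IsWienerIntegral.indepFun (hW : IsBrownianMotion W P) {S T : Type*}
    {f : S → ℝ → EuclideanSpace ℝ (Fin d)} {g : T → ℝ → EuclideanSpace ℝ (Fin d)}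
    {Z : S → Ω → ℝ} {Y : T → Ω → ℝ}
    (hf : ∀ i, IsWienerIntegral W P (f i) (Z i)) (hg : ∀ j, IsWienerIntegral W P (g j) (Y j))
    (h : ∀ i j, ∫ s, ⟪f i s, g j s⟫ = 0) :
    IndepFun (fun ω i => Z i ω) (fun ω j => Y j ω) P := by
  refine IsGaussianProcess.indepFun_of_covariance_eq_zero
    (IsWienerIntegral.isGaussianProcess hW (f := Sum.elim f g) ?_)
    (fun i => (hf i).memLp.1.aemeasurable) (fun j => (hg j).memLp.1.aemeasurable)
    fun i j => by rw [(hf i).covariance_eq hW (hg j), h]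
  rintro (i | j)
  · exact hf i
  · exact hg j

/-- **Kolmogorov's maximal inequality** for a square-integrable sequence with centered increments,
each independent of the past. -/
lemma kolmogorov_maximal_ineq {Y : ℕ → Ω → ℝ} (hY : ∀ k, MemLp (Y k) 2 P)
    (hI : ∀ k, IndepFun (fun ω (j : Set.Iic k) => Y j ω) (fun ω => Y (k + 1) ω - Y k ω) P)
    (h0 : ∀ k, ∫ ω, (Y (k + 1) ω - Y k ω) ∂P = 0) {ε : ℝ} (hε : 0 < ε) (n : ℕ) :
    P {ω | ∃ k ≤ n, ε ≤ |Y k ω|} ≤ ENNReal.ofReal ((∫ ω, Y n ω ^ 2 ∂P) / ε ^ 2) := by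
  wlog hm : ∀ k, StronglyMeasurable (Y k) generalizing Y
  · have hae (k : ℕ) := (hY k).1.ae_eq_mk
    have key := this (Y := fun k => (hY k).1.mk) (fun k => (memLp_congr_ae (hae k)).1 (hY k))
      (fun k => (hI k).congr ?_ ?_) (fun k => ?_) (fun k => (hY k).1.stronglyMeasurable_mk)
    · refine le_trans (measure_mono_ae ?_) (key.trans_eq ?_)
      · filter_upwards [ae_all_iff.2 hae] with ω h
        rintro ⟨k, hk, h'⟩
        exact ⟨k, hk, by rwa [← h k]⟩
      · congr 2
        refine integral_congr_ae ?_
        filter_upwards [hae n] with ω h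
        rw [h]
    · filter_upwards [ae_all_iff.2 hae] with ω h
      funext j
      exact h j
    · filter_upwards [ae_all_iff.2 hae] with ω h
      rw [h k, h (k + 1)]
    · rw [← h0 k]
      refine integral_congr_ae ?_
      filter_upwards [ae_all_iff.2 hae] with ω h
      rw [h k, h (k + 1)]
  let 𝒢 := Filtration.natural Y hm
  have hD (k : ℕ) : MemLp (fun ω => Y (k + 1) ω - Y k ω) 2 P := (hY (k + 1)).sub (hY k)
  have hsub : Submartingale (fun k ω => Y k ω ^ 2) 𝒢 P := by
    refine submartingale_of_setIntegral_le_succ (fun k => ?_) (fun k => (hY k).integrable_sq)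
      fun k s hs => ?_
    · exact (Filtration.stronglyAdapted_natural hm k).pow 2
    · have hle : 𝒢 k ≤ MeasurableSpace.comap (fun ω (j : Set.Iic k) => Y j ω) inferInstance :=
        (Filtration.natural_eq_comap Y hm k).le
      obtain ⟨B, hB, rfl⟩ := hle s hs
      set V := fun ω (j : Set.Iic k) => Y j ω with hV
      have hs' : MeasurableSet (V ⁻¹' B) := 𝒢.le k _ hs
      have hind : IndepFun (fun ω => (V ⁻¹' B).indicator (Y k) ω)
          (fun ω => Y (k + 1) ω - Y k ω) P := by
        have hG : Measurable fun v : Set.Iic k → ℝ =>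
            B.indicator (fun v => v ⟨k, le_refl k⟩) v :=
          (measurable_pi_apply _).indicator hB
        exact (hI k).comp hG measurable_id
      have hcross : ∫ ω in V ⁻¹' B, Y k ω * (Y (k + 1) ω - Y k ω) ∂P = 0 := by
        have := hind.integral_mul_eq_mul_integral ((hY k).1.indicator hs') (hD k).1
        rw [h0, mul_zero] at this
        rw [← integral_indicator hs', ← this]
        refine integral_congr_ae (ae_of_all _ fun ω => ?_)
        by_cases hω : ω ∈ V ⁻¹' B <;> simp [hω]
      have hi1 : Integrable (fun ω => Y k ω * (Y (k + 1) ω - Y k ω)) P :=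
        (hY k).integrable_mul (hD k)
      calc ∫ ω in V ⁻¹' B, Y k ω ^ 2 ∂P
          = ∫ ω in V ⁻¹' B, (Y k ω ^ 2 + 2 * (Y k ω * (Y (k + 1) ω - Y k ω))) ∂P := by
            rw [integral_add (hY k).integrable_sq.integrableOn
              (hi1.const_mul 2).integrableOn, integral_const_mul, hcross, mul_zero, add_zero]
        _ ≤ ∫ ω in V ⁻¹' B, Y (k + 1) ω ^ 2 ∂P := by
            refine setIntegral_mono
              ((hY k).integrable_sq.add (hi1.const_mul 2)).integrableOn
              (hY (k + 1)).integrable_sq.integrableOn fun ω => ?_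
            simp only
            nlinarith [sq_nonneg (Y (k + 1) ω - Y k ω)]
  have hmax := maximal_ineq hsub (fun k ω => sq_nonneg _) (ε := ⟨ε ^ 2, by positivity⟩) n
  rw [ENNReal.ofReal_div_of_pos (by positivity), ENNReal.le_div_iff_mul_le
    (Or.inl (by positivity)) (Or.inl (by simp)), mul_comm]
  have hset : {ω | ∃ k ≤ n, ε ≤ |Y k ω|} = {ω | ((⟨ε ^ 2, by positivity⟩ : ℝ≥0) : ℝ) ≤
      (Finset.range (n + 1)).sup' Finset.nonempty_range_add_one fun k => Y k ω ^ 2} := by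
    ext ω
    simp only [Set.mem_ofPred_eq, Finset.le_sup'_iff, Finset.mem_range,
      Nat.lt_succ_iff]
    refine exists_congr fun k => and_congr_right fun _ => ?_
    rw [← sq_abs (Y k ω), sq_le_sq₀ hε.le (abs_nonneg _)]
  rw [hset]
  refine le_trans (le_of_eq ?_) (hmax.trans (ENNReal.ofReal_le_ofReal ?_))
  · congr 1
    exact ENNReal.ofReal_eq_coe_nnreal _
  · exact setIntegral_le_integral (hY n).integrable_sq (ae_of_all _ fun ω => sq_nonneg _)

lemma inner_indicator_increment (ρ ρ' : ℝ → EuclideanSpace ℝ (Fin d)) {r s t : ℝ} (hrs : r ≤ s)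
    (hst : s ≤ t) (x : ℝ) :
    ⟪(Set.Ioc 0 r).indicator ρ x,
      ((Set.Ioc 0 t).indicator ρ' - (Set.Ioc 0 s).indicator ρ') x⟫ = 0 := by
  by_cases hx : x ∈ Set.Ioc 0 r
  · have h1 : x ∈ Set.Ioc 0 s := ⟨hx.1, hx.2.trans hrs⟩
    have h2 : x ∈ Set.Ioc 0 t := ⟨hx.1, h1.2.trans hst⟩
    simp [h1, h2]
  · simp [hx]

/-- **Doob's maximal inequality** for a continuous process of Wiener integrals. -/
lemma measure_exists_lt_abs_le (hW : IsBrownianMotion W P)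
    {ρ : ℝ → EuclideanSpace ℝ (Fin d)} {N : ℝ≥0 → Ω → ℝ}
    (hN : ∀ t : ℝ≥0, IsWienerIntegral W P ((Set.Ioc (0 : ℝ) t).indicator ρ) (N t))
    (hc : ∀ᵐ ω ∂P, Continuous fun t => N t ω) (S : ℝ≥0) {ε : ℝ} (hε : 0 < ε) :
    P {ω | ∃ t ≤ S, ε < |N t ω|} ≤
      ENNReal.ofReal ((∫ s in Set.Ioc (0 : ℝ) S, ‖ρ s‖ ^ 2) / ε ^ 2) := by
  -- the inequality along a monotone sequence of times
  have hgrid (u : ℕ → ℝ≥0) (hu : Monotone u) (huS : ∀ k, u k ≤ S) :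
      P {ω | ∃ k, ε ≤ |N (u k) ω|} ≤
        ENNReal.ofReal ((∫ s in Set.Ioc (0 : ℝ) S, ‖ρ s‖ ^ 2) / ε ^ 2) := by
    have hU : {ω | ∃ k, ε ≤ |N (u k) ω|} = ⋃ n, {ω | ∃ k ≤ n, ε ≤ |N (u k) ω|} := by
      ext ω
      simp only [Set.mem_ofPred_eq, Set.mem_iUnion]
      exact ⟨fun ⟨k, h⟩ => ⟨k, k, le_rfl, h⟩, fun ⟨_, k, _, h⟩ => ⟨k, h⟩⟩
    have hmono : Monotone fun n => {ω | ∃ k ≤ n, ε ≤ |N (u k) ω|} := by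
      rintro n m hnm ω ⟨k, hk, h⟩
      exact ⟨k, hk.trans hnm, h⟩
    rw [hU, hmono.measure_iUnion]
    refine iSup_le fun n => ?_
    have hinc (k : ℕ) := (hN (u (k + 1))).sub (hN (u k))
    refine (kolmogorov_maximal_ineq (Y := fun k => N (u k)) (fun k => (hN _).memLp)
      (fun k => ?_) (fun k => (hinc k).integral_eq_zero hW) hε n).trans
      (ENNReal.ofReal_le_ofReal ?_)
    · have := IsWienerIntegral.indepFun hW (S := Set.Iic k) (T := Unit) (fun j => hN (u j))
        (fun _ => hinc k) fun j _ => by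
          rw [integral_congr_ae (ae_of_all _ fun x => inner_indicator_increment ρ ρ
            (NNReal.coe_le_coe.2 (hu j.2)) (NNReal.coe_le_coe.2 (hu (Nat.le_succ k))) x)]
          simp
      exact this.comp measurable_id (measurable_pi_apply ())
    · rw [(hN (u n)).integral_sq hW]
      have e : ∫ s, ‖(Set.Ioc (0 : ℝ) (u n)).indicator ρ s‖ ^ 2 =
          ∫ s in Set.Ioc (0 : ℝ) (u n), ‖ρ s‖ ^ 2 := by
        rw [← integral_indicator measurableSet_Ioc]
        congr 1
        ext s
        by_cases hs : s ∈ Set.Ioc (0 : ℝ) (u n) <;> simp [hs]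
      rw [e]
      gcongr
      · exact ae_of_all _ fun s => sq_nonneg _
      · have := (memLp_indicator_iff_restrict measurableSet_Ioc).1 (hN S).memLp_left
        exact this.integrable_norm_pow (by norm_num)
      · exact huS n
  have hU : {ω | ∃ t ≤ S, ε < |N t ω|} ≤ᵐ[P]
      ⋃ m : ℕ, {ω | ∃ k : ℕ, ε ≤ |N (min (k / 2 ^ m) S) ω|} := by
    filter_upwards [hc] with ω hω
    rintro ⟨t, htS, ht⟩
    have hlim : Tendsto (fun m : ℕ => min (((⌊t * 2 ^ m⌋₊ : ℝ≥0)) / 2 ^ m) S) atTop (𝓝 t) := by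
      have h1 : Tendsto (fun m : ℕ => ((⌊t * 2 ^ m⌋₊ : ℝ≥0)) / 2 ^ m) atTop (𝓝 t) := by
        rw [← NNReal.tendsto_coe]
        have h2 := (tendsto_nat_floor_mul_div_atTop (R := ℝ) t.2).comp
          (tendsto_pow_atTop_atTop_of_one_lt (one_lt_two (α := ℝ)))
        refine h2.congr fun m => ?_
        simp only [Function.comp_apply, NNReal.coe_div, NNReal.coe_natCast, NNReal.coe_pow,
          NNReal.coe_ofNat]
        congr 2
      simpa [htS] using h1.min (tendsto_const_nhds (x := S))
    have h3 := ((hω.abs.tendsto t).comp hlim).eventually_const_lt ht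
    obtain ⟨m, hm⟩ := h3.exists
    exact Set.mem_iUnion.2 ⟨m, _, hm.le⟩
  refine (measure_mono_ae hU).trans ?_
  have hmono : Monotone fun m : ℕ => {ω | ∃ k : ℕ, ε ≤ |N (min (k / 2 ^ m) S) ω|} := by
    refine monotone_nat_of_le_succ fun m => ?_
    rintro ω ⟨k, hk⟩
    refine ⟨2 * k, ?_⟩
    have : ((2 * k : ℕ) : ℝ≥0) / 2 ^ (m + 1) = k / 2 ^ m := by
      push_cast
      rw [pow_succ', mul_div_mul_left _ _ two_ne_zero]
    rwa [this]
  rw [hmono.measure_iUnion]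
  refine iSup_le fun m => hgrid _ (fun k l hkl => ?_) fun k => min_le_right _ _
  gcongr

end Independence

/-! ### Path properties of the stochastic integral -/

section Paths

variable {Ω : Type*} [MeasurableSpace Ω] {P : Measure Ω} [IsProbabilityMeasure P] {d : ℕ}
  {W : ℝ≥0 → Ω → EuclideanSpace ℝ (Fin d)} {σ : ℝ≥0 → EuclideanSpace ℝ (Fin d)}
  {M : ℝ≥0 → Ω → ℝ}

lemma integral_norm_sq_increment {ρ : ℝ → EuclideanSpace ℝ (Fin d)} {s t : ℝ} (hs : 0 ≤ s)
    (hst : s ≤ t) :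
    ∫ x, ‖((Set.Ioc 0 t).indicator ρ - (Set.Ioc 0 s).indicator ρ) x‖ ^ 2 =
      ∫ x in Set.Ioc s t, ‖ρ x‖ ^ 2 := by
  rw [← integral_indicator measurableSet_Ioc]
  congr 1
  ext x
  by_cases h1 : x ∈ Set.Ioc 0 s
  · have h2 : x ∈ Set.Ioc 0 t := ⟨h1.1, h1.2.trans hst⟩
    have h3 : x ∉ Set.Ioc s t := fun h => absurd h.1 (not_lt.2 h1.2)
    simp [h1, h2, h3]
  · by_cases h2 : x ∈ Set.Ioc 0 t
    · have h3 : x ∈ Set.Ioc s t := ⟨not_le.1 fun h => h1 ⟨h2.1, h⟩, h2.2⟩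
      simp [h1, h2, h3]
    · have h3 : x ∉ Set.Ioc s t := fun h => h2 ⟨hs.trans_lt h.1, h.2⟩
      simp [h1, h2, h3]

lemma integral_norm_sq_ge {κ : ℝ} (hκ : 0 ≤ κ) (hσ : Continuous σ)
    (hlow : ∀ t, κ ≤ ‖σ t‖) {s t : ℝ} (hst : s ≤ t) :
    κ ^ 2 * (t - s) ≤ ∫ x in Set.Ioc s t, ‖σ x.toNNReal‖ ^ 2 := by
  have hc : Continuous fun x : ℝ => ‖σ x.toNNReal‖ ^ 2 := by fun_prop
  calc κ ^ 2 * (t - s) = ∫ x in Set.Ioc s t, κ ^ 2 := by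
        simp [hst, mul_comm]
    _ ≤ _ := by
        refine setIntegral_mono (by simp) (hc.integrableOn_Ioc) fun x => ?_
        exact pow_le_pow_left₀ hκ (hlow _) 2

lemma integral_norm_sq_le {K : ℝ} (hσ : Continuous σ) (hup : ∀ t, ‖σ t‖ ≤ K) {s t : ℝ}
    (hst : s ≤ t) :
    ∫ x in Set.Ioc s t, ‖σ x.toNNReal‖ ^ 2 ≤ K ^ 2 * (t - s) := by
  have hc : Continuous fun x : ℝ => ‖σ x.toNNReal‖ ^ 2 := by fun_prop
  calc _ ≤ ∫ x in Set.Ioc s t, K ^ 2 := by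
        refine setIntegral_mono (hc.integrableOn_Ioc) (by simp) fun x => ?_
        exact pow_le_pow_left₀ (norm_nonneg _) (hup _) 2
    _ = _ := by simp [hst, mul_comm]

/-- A centered Gaussian variable is below minus its standard deviation with a probability that
does not depend on the variance. -/
lemma gaussianReal_Iio_neg_sqrt {v : ℝ≥0} (hv : v ≠ 0) :
    gaussianReal 0 v (Set.Iio (-√v)) = gaussianReal 0 1 (Set.Iio (-1)) := by
  have h : gaussianReal 0 v = (gaussianReal 0 1).map (√v * ·) := by
    rw [gaussianReal_map_const_mul, mul_zero, mul_one]
    congr 1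
    ext
    simp
  have hpos : 0 < √(v : ℝ) := Real.sqrt_pos.2 (by positivity)
  rw [h, Measure.map_apply (by fun_prop) measurableSet_Iio]
  congr 1
  ext x
  simp only [Set.mem_preimage, Set.mem_Iio]
  constructor <;> intro hx <;> nlinarith

lemma gaussianReal_Iio_pos (a : ℝ) : 0 < gaussianReal 0 1 (Set.Iio a) := by
  refine pos_iff_ne_zero.2 fun h => ?_
  have := gaussianReal_absolutelyContinuous' 0 one_ne_zero h
  simp at this

/-- Almost surely, `M` crosses every line `t ↦ -c t` immediately after time `0`. Along the times
`t k = (k + 1)!⁻²` the increments `M (t k) - M (t (k + 1))` are independent and below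
`- κ √(t k) / 2` with a probability bounded away from `0`, hence infinitely often, whereas
`M (t (k + 1))` is eventually negligible with respect to `√(t k)`. -/
lemma ae_exists_lt_neg_mul (hW : IsBrownianMotion W P) (hσ : Continuous σ)
    (hM : IsStochasticIntegral W σ M P) {κ K : ℝ} (hκ : 0 < κ) (hlow : ∀ t, κ ≤ ‖σ t‖)
    (hup : ∀ t, ‖σ t‖ ≤ K) (c : ℝ) :
    ∀ᵐ ω ∂P, ∀ δ > 0, ∃ t : ℝ≥0, 0 < t ∧ t < δ ∧ M t ω < -c * t := by
  let r : ℕ → ℝ≥0 := fun k => ((k + 1).factorial : ℝ≥0)⁻¹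
  let t : ℕ → ℝ≥0 := fun k => r k ^ 2
  have hr0 (k : ℕ) : 0 < r k := by positivity
  have hr (k : ℕ) : r (k + 1) = r k / (k + 2) := by
    simp only [r]
    rw [Nat.factorial_succ (k + 1)]
    push_cast
    rw [mul_inv, div_eq_mul_inv, mul_comm]
    ring
  have hrlim : Tendsto r atTop (𝓝 0) := by
    have h1 : Tendsto (fun k : ℕ => (k + 1).factorial) atTop atTop :=
      tendsto_atTop_mono (fun k => (Nat.self_le_factorial (k + 1))) (tendsto_add_atTop_nat 1)
    exact tendsto_inv_atTop_zero.comp (tendsto_natCast_atTop_atTop.comp h1)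
  have hra : Antitone r := antitone_nat_of_succ_le fun k => by
    rw [hr]
    exact div_le_self zero_le (by exact_mod_cast Nat.le_add_left 1 (k + 1))
  have hta : Antitone t := fun i j hij => pow_le_pow_left₀ zero_le (hra hij) 2
  have htc (k : ℕ) : ((t k : ℝ≥0) : ℝ) = (r k : ℝ) ^ 2 := by simp [t]
  have hwi (s : ℝ≥0) := hM.isWienerIntegral hW hσ s
  let D : ℕ → Ω → ℝ := fun k => M (t k) - M (t (k + 1))
  have hD (k : ℕ) := (hwi (t k)).sub (hwi (t (k + 1)))
  -- the increments are independent
  have hind : iIndepFun D P := by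
    have horth (i j : ℕ) (hij : i < j) := fun x => inner_indicator_increment
      (fun s : ℝ => σ s.toNNReal) (fun s : ℝ => σ s.toNNReal)
      (NNReal.coe_le_coe.2 (hta (Nat.succ_le_of_lt hij)))
      (NNReal.coe_le_coe.2 (hta (Nat.le_succ i))) x
    have horth' (i j : ℕ) (hij : i < j) := fun x => inner_indicator_increment
      (fun s : ℝ => σ s.toNNReal) (fun s : ℝ => σ s.toNNReal)
      (NNReal.coe_le_coe.2 (hta ((Nat.succ_le_of_lt hij).trans (Nat.le_succ j))))
      (NNReal.coe_le_coe.2 (hta (Nat.le_succ i))) x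
    have hcov (i j : ℕ) (hij : i < j) : cov[D j, D i; P] = 0 := by
      rw [(hD j).covariance_eq hW (hD i), integral_congr_ae (g := 0)]
      · simp
      · refine ae_of_all _ fun x => ?_
        exact (inner_sub_left _ _ _).trans
          ((congrArg₂ (· - ·) (horth i j hij x) (horth' i j hij x)).trans (sub_zero 0))
    have := IsGaussianProcess.iIndepFun_of_covariance_eq_zero (S := fun _ : ℕ => Unit)
      (X := fun k _ => D k)
      (IsWienerIntegral.isGaussianProcess hW (ι := (_ : ℕ) × Unit) fun p => hD p.1)
      (fun k _ => (hD k).memLp.1.aemeasurable) fun i j hij _ _ => by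
        rcases lt_or_gt_of_ne hij with h | h
        · rw [covariance_comm, hcov i j h]
        · exact hcov j i h
    exact this.comp (fun _ x => x ()) fun _ => measurable_pi_apply ()
  -- the increments are very negative infinitely often
  have hio : ∀ᵐ ω ∂P, ∃ᶠ k in atTop, D k ω < -(κ / 2 * r k) := by
    have hae (k : ℕ) := (hD k).memLp.1.ae_eq_mk
    let D' : ℕ → Ω → ℝ := fun k => (hD k).memLp.1.mk
    have hD'm (k : ℕ) : Measurable (D' k) := (hD k).memLp.1.stronglyMeasurable_mk.measurable
    have hind' : iIndepFun D' P := hind.congr hae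
    let A : ℕ → Set Ω := fun k => D' k ⁻¹' Set.Iio (-(κ / 2 * r k))
    have hAm (k : ℕ) : MeasurableSet (A k) := hD'm k measurableSet_Iio
    have hAind : iIndepSet A P := by
      rw [iIndepSet_iff_meas_biInter hAm]
      intro s
      exact hind'.measure_inter_preimage_eq_mul s fun _ _ => measurableSet_Iio
    have hAp (k : ℕ) : gaussianReal 0 1 (Set.Iio (-1)) ≤ P (A k) := by
      have hlaw := ((hD k).hasLaw hW).congr (hae k).symm
      rw [integral_norm_sq_increment (NNReal.coe_nonneg _)
        (NNReal.coe_le_coe.2 (hta (Nat.le_succ k)))] at hlaw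
      set V : ℝ := ∫ x in Set.Ioc (t (k + 1) : ℝ) (t k), ‖σ x.toNNReal‖ ^ 2
      have hV : (κ / 2 * r k) ^ 2 ≤ V := by
        refine le_trans ?_ (integral_norm_sq_ge hκ.le hσ hlow
          (NNReal.coe_le_coe.2 (hta (Nat.le_succ k))))
        have h2 : (r (k + 1) : ℝ) ≤ r k / 2 := by
          rw [hr]
          push_cast
          gcongr
          linarith [Nat.cast_nonneg (α := ℝ) k]
        have h3 : (0 : ℝ) ≤ r (k + 1) := (r (k + 1)).2
        have h4 : (0 : ℝ) ≤ r k := (r k).2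
        rw [htc, htc]
        have h5 : (r (k + 1) : ℝ) ^ 2 ≤ (r k / 2) ^ 2 := pow_le_pow_left₀ h3 h2 2
        nlinarith [mul_nonneg (sq_nonneg κ) (sq_nonneg (r k : ℝ)),
          mul_le_mul_of_nonneg_left h5 (sq_nonneg κ)]
      have hVpos : 0 < V := lt_of_lt_of_le
        (by have : (0 : ℝ) < r k := hr0 k
            positivity) hV
      have hV0 : V.toNNReal ≠ 0 := by simpa using hVpos
      calc gaussianReal 0 1 (Set.Iio (-1)) = gaussianReal 0 V.toNNReal (Set.Iio (-√V.toNNReal)) :=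
            (gaussianReal_Iio_neg_sqrt hV0).symm
        _ ≤ gaussianReal 0 V.toNNReal (Set.Iio (-(κ / 2 * r k))) := by
            refine measure_mono (Set.Iio_subset_Iio (neg_le_neg ?_))
            rw [Real.coe_toNNReal _ hVpos.le]
            exact Real.le_sqrt_of_sq_le hV
        _ = P (A k) := by
            rw [← hlaw.map_eq, Measure.map_apply (hD'm k) measurableSet_Iio]
    have hsum : ∑' k, P (A k) = ⊤ := by
      refine top_le_iff.1 (le_trans (le_of_eq ?_) (ENNReal.tsum_le_tsum hAp))
      exact (ENNReal.tsum_const_eq_top_of_ne_zero (gaussianReal_Iio_pos (-1)).ne').symm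
    have hone := measure_limsup_eq_one hAm hAind hsum
    have hmem : limsup A atTop ∈ ae P :=
      (mem_ae_iff_prob_eq_one (MeasurableSet.measurableSet_limsup hAm)).2 hone
    filter_upwards [hmem, ae_all_iff.2 hae] with ω h h'
    refine (mem_limsup_iff_frequently_mem.1 h).mono fun k hk => ?_
    rw [show D k ω = D' k ω from h' k]
    exact hk
  -- the remainders are negligible
  have hrem : ∀ᵐ ω ∂P, ∀ᶠ k in atTop, |M (t (k + 1)) ω| ≤ κ / 4 * r k := by
    let B : ℕ → Set Ω := fun k => {ω | ∃ s ≤ t (k + 1), κ / 4 * r k < |M s ω|}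
    have hB (k : ℕ) : P (B k) ≤
        ENNReal.ofReal (16 * K ^ 2 / κ ^ 2 * (1 / ((k + 1 : ℕ) : ℝ) ^ 2)) := by
      have h4 : (0 : ℝ) < r k := hr0 k
      refine (measure_exists_lt_abs_le hW hwi hM.cont (t (k + 1)) (by positivity)).trans
        (ENNReal.ofReal_le_ofReal ?_)
      have h1 := integral_norm_sq_le hσ hup (NNReal.coe_nonneg (t (k + 1)))
      have h2 : ((t (k + 1) : ℝ≥0) : ℝ) = (r k / (k + 2)) ^ 2 := by
        rw [htc, hr]
        push_cast
        rfl
      calc _ ≤ K ^ 2 * (r k / (k + 2)) ^ 2 / (κ / 4 * r k) ^ 2 := by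
            rw [← h2, ← sub_zero ((t (k + 1) : ℝ≥0) : ℝ)]
            gcongr
            simpa using h1
        _ = 16 * K ^ 2 / κ ^ 2 * (1 / ((k : ℝ) + 2) ^ 2) := by field_simp; ring
        _ ≤ _ := by
          push_cast
          gcongr
          linarith
    have hsum : ∑' k, P (B k) ≠ ⊤ := by
      refine ne_top_of_le_ne_top ?_ (ENNReal.tsum_le_tsum hB)
      have hs : Summable fun k : ℕ => 16 * K ^ 2 / κ ^ 2 * (1 / ((k + 1 : ℕ) : ℝ) ^ 2) :=
        ((summable_nat_add_iff 1).2
          (Real.summable_one_div_nat_pow.2 one_lt_two)).mul_left _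
      exact hs.tsum_ofReal_ne_top
    filter_upwards [ae_eventually_notMem hsum] with ω hω
    filter_upwards [hω] with k hk
    exact not_lt.1 fun h => hk ⟨t (k + 1), le_rfl, h⟩
  filter_upwards [hio, hrem] with ω h1 h2 δ hδ
  have hrlim' : Tendsto (fun k => (r k : ℝ)) atTop (𝓝 0) :=
    (NNReal.continuous_coe.tendsto 0).comp hrlim
  have h3 : ∀ᶠ k in atTop, c * r k ≤ κ / 4 := by
    have : Tendsto (fun k => c * (r k : ℝ)) atTop (𝓝 0) := by simpa using hrlim'.const_mul c
    exact this.eventually_le_const (by positivity)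
  have h4 : ∀ᶠ k in atTop, t k < δ := by
    have : Tendsto t atTop (𝓝 0) := by simpa using hrlim.pow 2
    exact this.eventually_lt_const hδ
  obtain ⟨k, hk1, hk2, hk3, hk4⟩ := (h1.and_eventually (h2.and (h3.and h4))).exists
  refine ⟨t k, by positivity, hk4, ?_⟩
  have hrk : (0 : ℝ) < r k := hr0 k
  have : M (t k) ω = D k ω + M (t (k + 1)) ω := by simp [D]
  rw [this, htc]
  nlinarith [(abs_le.1 hk2).2, mul_le_mul_of_nonneg_right hk3 hrk.le]

end Paths

section NoAtom

variable {Ω : Type*} [MeasurableSpace Ω] {P : Measure Ω} [IsProbabilityMeasure P] {d : ℕ}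
  {W : ℝ≥0 → Ω → EuclideanSpace ℝ (Fin d)} {σ : ℝ≥0 → EuclideanSpace ℝ (Fin d)}
  {M : ℝ≥0 → Ω → ℝ}

/-- The infimum of `a + v` equals `0` for at most one constant `a`. -/
lemma subsingleton_translation_inf_eq_zero {ι : Type*} (v : ι → ℝ) :
    {a : ℝ | (∀ i, 0 ≤ a + v i) ∧ ∀ k : ℕ, ∃ i, a + v i < 1 / ((k : ℝ) + 1)}.Subsingleton := by
  have key : ∀ a b : ℝ, (∀ i, 0 ≤ a + v i) → (∀ k : ℕ, ∃ i, b + v i < 1 / ((k : ℝ) + 1)) →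
      b ≤ a := by
    intro a b ha hb
    by_contra! hab
    obtain ⟨k, hk⟩ := exists_nat_one_div_lt (sub_pos.2 hab)
    obtain ⟨i, hi⟩ := hb k
    linarith [ha i]
  exact fun a ha b hb => le_antisymm (key b a hb.1 ha.2) (key a b ha.1 hb.2)

/-- For `δ > 0`, the infimum over times `t ≥ δ` of `X₀ + M_t - g(t)` has no atom at `0`: given `X₀`
and the increments of `M` after time `δ`, it is a translate of the independent Gaussian variable
`M_δ`. -/
lemma measure_inf_eq_zero (hW : IsBrownianMotion W P) (hσ : Continuous σ)
    (hM : IsStochasticIntegral W σ M P) {κ : ℝ} (hκ : 0 < κ) (hlow : ∀ t, κ ≤ ‖σ t‖)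
    {X₀ : Ω → ℝ} (hX₀ : AEMeasurable X₀ P) (hind : IndepFun X₀ (fun ω t => W t ω) P)
    (g : ℝ≥0 → ℝ) {δ : ℝ≥0} (hδ : 0 < δ) {C : Set ℝ≥0} (hC : C.Countable) (hCδ : ∀ t ∈ C, δ ≤ t) :
    ∀ᵐ ω ∂P, ¬ ((∀ t ∈ C, 0 ≤ X₀ ω + M t ω - g t) ∧
      ∀ k : ℕ, ∃ t ∈ C, X₀ ω + M t ω - g t < 1 / ((k : ℝ) + 1)) := by
  have : Countable C := hC.to_subtype
  have hwi (s : ℝ≥0) := hM.isWienerIntegral hW hσ s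
  let B : Ω → C → ℝ := fun ω t => M t ω - M δ ω
  have hB (t : C) := (hwi t).sub (hwi δ)
  have hBm : AEMeasurable B P := aemeasurable_pi_lambda _ fun t => (hB t).memLp.1.aemeasurable
  have hMm : AEMeasurable (M δ) P := (hwi δ).memLp.1.aemeasurable
  -- the increments after `δ` are independent of `M δ`
  have hBM : IndepFun B (M δ) P := by
    have := (IsWienerIntegral.indepFun hW (S := Unit) (T := C) (fun _ => hwi δ) hB
      fun _ t => by
        rw [integral_congr_ae (ae_of_all _ fun x => inner_indicator_increment
          (fun s : ℝ => σ s.toNNReal) (fun s : ℝ => σ s.toNNReal) le_rfl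
          (NNReal.coe_le_coe.2 (hCδ t t.2)) x)]
        simp)
    exact (this.comp (measurable_pi_apply ()) measurable_id).symm
  -- both are independent of `X₀`
  have hX : IndepFun X₀ (fun ω => (B ω, M δ ω)) P := by
    choose F hF hFe using fun t => (hB t).exists_measurable
    obtain ⟨G, hG, hGe⟩ := (hwi δ).exists_measurable
    have h1 : IndepFun X₀ (fun ω => ((fun t => F t fun s => W s ω), G fun s => W s ω)) P :=
      hind.comp measurable_id ((measurable_pi_lambda _ hF).prodMk hG)
    refine h1.congr EventuallyEq.rfl ?_
    filter_upwards [ae_all_iff.2 hFe, hGe] with ω h2 h3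
    refine Prod.ext (funext fun t => ?_) h3.symm
    exact (h2 t).symm
  have hNA : ∀ a, P.map (M δ) {a} = 0 := by
    intro a
    rw [((hwi δ).hasLaw hW).map_eq]
    have hv : (∫ s, ‖(Set.Ioc (0 : ℝ) δ).indicator (fun s => σ s.toNNReal) s‖ ^ 2).toNNReal ≠
        0 := by
      have h := integral_norm_sq_increment (ρ := fun s : ℝ => σ s.toNNReal) le_rfl
        (NNReal.coe_nonneg δ)
      simp only [Set.Ioc_self, Set.indicator_empty] at h
      have h2 := integral_norm_sq_ge hκ.le hσ hlow (NNReal.coe_nonneg δ)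
      rw [← h] at h2
      have h3 : 0 < κ ^ 2 * ((δ : ℝ) - 0) := by
        have : (0 : ℝ) < δ := hδ
        rw [sub_zero]
        positivity
      have h4 := h3.trans_le h2
      simpa using h4
    have := nullSingletonClass_gaussianReal (μ := 0) hv
    exact measure_singleton a
  let E : Set (ℝ × ((C → ℝ) × ℝ)) := {p | (∀ t : C, 0 ≤ p.2.2 + (p.1 + p.2.1 t - g t)) ∧
    ∀ k : ℕ, ∃ t : C, p.2.2 + (p.1 + p.2.1 t - g t) < 1 / ((k : ℝ) + 1)}
  have hE : MeasurableSet E := by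
    have : E = (⋂ t : C, {p | 0 ≤ p.2.2 + (p.1 + p.2.1 t - g t)}) ∩
        ⋂ k : ℕ, ⋃ t : C, {p | p.2.2 + (p.1 + p.2.1 t - g t) < 1 / ((k : ℝ) + 1)} := by
      ext p
      simp [E]
    rw [this]
    exact (MeasurableSet.iInter fun t => measurableSet_le (by fun_prop) (by fun_prop)).inter
      (MeasurableSet.iInter fun k => MeasurableSet.iUnion fun t =>
        measurableSet_lt (by fun_prop) (by fun_prop))
  have hnull : P.map (fun ω => (X₀ ω, (B ω, M δ ω))) E = 0 := by
    rw [(indepFun_iff_map_prod_eq_prod_map_map hX₀ (hBm.prodMk hMm)).1 hX,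
      (indepFun_iff_map_prod_eq_prod_map_map hBm hMm).1 hBM, Measure.measure_prod_null hE]
    refine ae_of_all _ fun x => ?_
    refine (Measure.measure_prod_null (measurable_prodMk_left hE)).2 (ae_of_all _ fun b => ?_)
    have hsub : (Prod.mk b ⁻¹' (Prod.mk x ⁻¹' E)).Subsingleton :=
      subsingleton_translation_inf_eq_zero fun t : C => x + b t - g t
    change P.map (M δ) (Prod.mk b ⁻¹' (Prod.mk x ⁻¹' E)) = 0
    rcases hsub.eq_empty_or_singleton with h | ⟨a, h⟩
    · rw [h]
      exact measure_empty
    · rw [h]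
      exact hNA a
  rw [Measure.map_apply_of_aemeasurable (hX₀.prodMk (hBm.prodMk hMm)) hE] at hnull
  filter_upwards [measure_eq_zero_iff_ae_notMem.1 hnull] with ω hω h
  refine hω ⟨fun t => ?_, fun k => ?_⟩
  · have := h.1 t t.2
    simp only [B]
    linarith
  · obtain ⟨t, ht, h'⟩ := h.2 k
    refine ⟨⟨t, ht⟩, ?_⟩
    simp only [B]
    linarith

end NoAtom

/-! ### Hitting times of a single path -/

section HittingTime

variable {Ω : Type*} {γ : ℝ≥0 → ℝ} {X : ℝ≥0 → Ω → ℝ} {T : ℝ≥0} {ω : Ω}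

lemma lowerHittingTime_le_right : lowerHittingTime γ X T ω ≤ T :=
  hittingBtwn_le ω

lemma lowerHittingTime_le {t : ℝ≥0} (h : X t ω ≤ γ t) :
    lowerHittingTime γ X T ω ≤ t := by
  by_contra! hlt
  exact notMem_of_lt_hittingBtwn hlt zero_le (sub_nonneg.2 h)

lemma lt_of_lt_lowerHittingTime {t : ℝ≥0} (h : t < lowerHittingTime γ X T ω) : γ t < X t ω := by
  by_contra! hle
  exact absurd (lowerHittingTime_le hle) (not_le.2 h)

lemma le_lowerHittingTime {u : ℝ≥0} (hu : u ≤ T) (h : ∀ t < u, γ t < X t ω) :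
    u ≤ lowerHittingTime γ X T ω := by
  by_contra! hlt
  unfold lowerHittingTime hittingBtwn at hlt
  split_ifs at hlt with hex
  · obtain ⟨j, hj, hj'⟩ := hex
    obtain ⟨t, ht, htu⟩ := exists_lt_of_csInf_lt
      (Set.nonempty_of_mem (x := j) (s := Set.Icc 0 T ∩ {i | γ i - X i ω ∈ Set.Ici 0})
        ⟨hj, hj'⟩) hlt
    have h1 : (0 : ℝ) ≤ γ t - X t ω := ht.2
    linarith [h t htu]
  · exact absurd hu (not_le.2 hlt)

/-- The inequality is strict since, by continuity, the path stays above the boundary on a right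
neighbourhood of `s`. -/
lemma lt_lowerHittingTime (hγ : ContinuousOn γ (Set.Ico 0 T)) (hX : Continuous fun t => X t ω)
    {s : ℝ≥0} (hs : s < T) (h : ∀ t ≤ s, γ t < X t ω) : s < lowerHittingTime γ X T ω := by
  have hev : ∀ᶠ t in 𝓝[Set.Ico 0 T] s, γ t < X t ω :=
    (hγ s ⟨zero_le, hs⟩).eventually_lt hX.continuousWithinAt (h s le_rfl)
  have hmem : Set.Ico 0 T ∈ 𝓝 s := by
    have : Set.Ico (0 : ℝ≥0) T = Set.Iio T := by
      ext
      simp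
    rw [this]
    exact Iio_mem_nhds hs
  rw [nhdsWithin_eq_nhds.2 hmem] at hev
  obtain ⟨u, hu, hsub⟩ := exists_Ico_subset_of_mem_nhds hev ⟨T, hs⟩
  refine (lt_min hu hs).trans_le (le_lowerHittingTime (min_le_right u T) fun t ht => ?_)
  rcases le_or_gt t s with hts | hts
  · exact h t hts
  · exact hsub ⟨hts.le, ht.trans_le (min_le_left _ _)⟩

/-- Stability of the hitting time under uniform perturbations, at a path that goes strictly below
the boundary immediately after hitting it. -/
lemma tendsto_lowerHittingTime {γ' : ℕ → ℝ≥0 → ℝ} {X' : ℕ → ℝ≥0 → Ω → ℝ}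
    (hγ : ContinuousOn γ (Set.Ico 0 T)) (hX : Continuous fun t => X t ω)
    (hγ' : TendstoLocallyUniformlyOn γ' γ atTop (Set.Ico 0 T))
    (hX' : TendstoUniformlyOn (fun n t => X' n t ω) (fun t => X t ω) atTop (Set.Iic T))
    (hreg : ∀ s < T, lowerHittingTime γ X T ω < s → ∃ t ≤ s, X t ω < γ t) :
    Tendsto (fun n => lowerHittingTime (γ' n) (X' n) T ω) atTop
      (𝓝 (lowerHittingTime γ X T ω)) := by
  refine tendsto_order.2 ⟨fun a ha => ?_, fun b hb => ?_⟩
  · obtain ⟨a', haa', ha'⟩ := exists_between ha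
    have ha'T : a' < T := ha'.trans_le lowerHittingTime_le_right
    have hsub : Set.Icc 0 a' ⊆ Set.Ico 0 T := fun t ht => ⟨ht.1, ht.2.trans_lt ha'T⟩
    -- the distance to the boundary is bounded below on `[0, a']`
    obtain ⟨t₀, ht₀, hmin⟩ := isCompact_Icc.exists_isMinOn (Set.nonempty_Icc.2 (zero_le (a := a')))
      (hX.continuousOn.sub (hγ.mono hsub))
    have hη : 0 < X t₀ ω - γ t₀ := sub_pos.2 (lt_of_lt_lowerHittingTime (ht₀.2.trans_lt ha'))
    have h1 := (tendstoLocallyUniformlyOn_iff_tendstoUniformlyOn_of_compact isCompact_Icc).1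
      (hγ'.mono hsub)
    filter_upwards [Metric.tendstoUniformlyOn_iff.1 h1 _ (half_pos hη),
      Metric.tendstoUniformlyOn_iff.1 hX' _ (half_pos hη)] with n hn1 hn2
    refine haa'.trans_le (le_lowerHittingTime ha'T.le fun t ht => ?_)
    have h3 := hn1 t ⟨zero_le, ht.le⟩
    have h4 := hn2 t (ht.trans ha'T).le
    have h5 : X t₀ ω - γ t₀ ≤ X t ω - γ t := hmin ⟨zero_le, ht.le⟩
    rw [Real.dist_eq, abs_lt] at h3 h4
    linarith
  · rcases (lowerHittingTime_le_right (γ := γ) (X := X) (T := T) (ω := ω)).lt_or_eq with hT | hT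
    · obtain ⟨s, hs1, hs2⟩ := exists_between (lt_min hb hT)
      obtain ⟨t, hts, ht⟩ := hreg s (hs2.trans_le (min_le_right _ _)) hs1
      have htT : t < T := hts.trans_lt (hs2.trans_le (min_le_right _ _))
      have h1 := hγ'.tendsto_at (a := t) ⟨zero_le, htT⟩
      have h2 := hX'.tendsto_at (x := t) htT.le
      filter_upwards [h2.eventually_lt h1 ht] with n hn
      exact (lowerHittingTime_le hn.le).trans_lt
        (hts.trans_lt (hs2.trans_le (min_le_left _ _)))
    · rw [hT] at hb
      exact Eventually.of_forall fun n => lowerHittingTime_le_right.trans_lt hb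

end HittingTime

section Measurability

variable {Ω : Type*} [MeasurableSpace Ω] {P : Measure Ω} {γ : ℝ≥0 → ℝ} {X : ℝ≥0 → Ω → ℝ} {T : ℝ≥0}

/-- Up to a null set, `{s < τ}` is the event that the distance to the boundary is bounded below along
a countable dense set of times in `[0, s]`, parametrised by `t ↦ min t s`. -/
lemma aemeasurable_lowerHittingTime (hγ : ContinuousOn γ (Set.Ico 0 T))
    (hX : ∀ᵐ ω ∂P, Continuous fun t => X t ω) (hXm : ∀ t, AEMeasurable (X t) P) :
    AEMeasurable (lowerHittingTime γ X T) P := by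
  obtain ⟨S, hSc, hSd⟩ := TopologicalSpace.exists_countable_dense ℝ≥0
  have hnull (s : ℝ≥0) : NullMeasurableSet {ω | s < lowerHittingTime γ X T ω} P := by
    rcases lt_or_ge s T with hs | hs
    swap
    · have : {ω | s < lowerHittingTime γ X T ω} = ∅ := by
        ext ω
        simpa using lowerHittingTime_le_right.trans hs
      rw [this]
      exact nullMeasurableSet_empty
    have hE : NullMeasurableSet (⋃ k : ℕ, ⋂ t ∈ S,
        {ω | γ (min t s) + 1 / ((k : ℝ) + 1) ≤ X (min t s) ω}) P :=
      .iUnion fun k => .biInter hSc fun t _ => nullMeasurableSet_le aemeasurable_const (hXm _)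
    refine hE.congr ?_
    filter_upwards [hX] with ω hω
    have hc : Continuous fun t => X (min t s) ω - γ (min t s) := by
      refine (hω.comp (continuous_id.min continuous_const)).sub
        (hγ.comp_continuous (continuous_id.min continuous_const) fun t => ?_)
      exact ⟨zero_le, (min_le_right _ _).trans_lt hs⟩
    refine propext ?_
    change ω ∈ ⋃ k : ℕ, ⋂ t ∈ S, {ω | γ (min t s) + 1 / ((k : ℝ) + 1) ≤ X (min t s) ω} ↔
      s < lowerHittingTime γ X T ω
    simp only [Set.mem_iUnion, Set.mem_iInter, Set.mem_ofPred_eq]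
    constructor
    · rintro ⟨k, hk⟩
      have hk' : ∀ t, 1 / ((k : ℝ) + 1) ≤ X (min t s) ω - γ (min t s) := by
        intro t
        by_contra! hlt
        obtain ⟨u, hu, hu'⟩ := hSd.exists_mem_open (isOpen_Iio.preimage hc) ⟨t, hlt⟩
        have h1 : X (min u s) ω - γ (min u s) < 1 / ((k : ℝ) + 1) := hu'
        linarith [hk u hu]
      refine lt_lowerHittingTime hγ hω hs fun t hts => ?_
      have h1 := hk' t
      rw [min_eq_left hts] at h1
      have h2 : (0 : ℝ) < 1 / ((k : ℝ) + 1) := by positivity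
      linarith
    · intro h
      obtain ⟨t₀, -, hmin⟩ := isCompact_Icc.exists_isMinOn (Set.nonempty_Icc.2 (zero_le (a := s)))
        hc.continuousOn
      have hpos : 0 < X (min t₀ s) ω - γ (min t₀ s) :=
        sub_pos.2 (lt_of_lt_lowerHittingTime ((min_le_right _ _).trans_lt h))
      obtain ⟨k, hk⟩ := exists_nat_one_div_lt hpos
      refine ⟨k, fun t _ => ?_⟩
      have h1 : X (min t₀ s) ω - γ (min t₀ s) ≤ X (min (min t s) s) ω - γ (min (min t s) s) :=
        hmin (show min t s ∈ Set.Icc 0 s from ⟨zero_le, min_le_right _ _⟩)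
      rw [min_eq_left (min_le_right t s)] at h1
      linarith
  refine NullMeasurable.aemeasurable fun s hs => ?_
  have hm : @Measurable (NullMeasurableSpace Ω P) ℝ≥0 _ _ (lowerHittingTime γ X T) :=
    measurable_of_Ioi fun s => hnull s
  exact hm hs

end Measurability

/-! ### Solutions and their hitting times -/

section Solutions

variable {Ω : Type*} [MeasurableSpace Ω] {P : Measure Ω} {d : ℕ}
  {W : ℝ≥0 → Ω → EuclideanSpace ℝ (Fin d)} {μ : ℝ≥0 → ℝ}
  {σ : ℝ≥0 → EuclideanSpace ℝ (Fin d)} {X : ℝ≥0 → Ω → ℝ}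

lemma IsStochasticIntegral.neg {M : ℝ≥0 → Ω → ℝ} (hM : IsStochasticIntegral W σ M P) :
    IsStochasticIntegral W (fun t => -σ t) (fun t ω => -M t ω) P where
  cont := hM.cont.mono fun ω h => h.neg
  memLp t := (hM.memLp t).neg
  approx t := by
    obtain ⟨φ, h1, h2⟩ := hM.approx t
    let ψ : ℕ → StepFunction d := fun m => { φ m with val := fun j => -(φ m).val j }
    have he (m : ℕ) (s : ℝ≥0) : (ψ m).eval s = -(φ m).eval s := by
      simp only [StepFunction.eval, ψ, ← Finset.sum_neg_distrib]
      refine Finset.sum_congr rfl fun j _ => ?_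
      simp only [Set.indicator_apply]
      split_ifs <;> simp
    have hi (m : ℕ) (ω : Ω) : (ψ m).integral W t ω = -(φ m).integral W t ω := by
      simp [StepFunction.integral, ψ]
    refine ⟨ψ, h1.congr fun m => ?_, h2.congr fun m => ?_⟩
    · refine lintegral_congr fun s => ?_
      rw [he, ← enorm_neg]
      congr 2
      abel
    · rw [← eLpNorm_neg]
      congr 1
      ext ω
      simp only [Pi.neg_apply, hi]
      ring

lemma IsSolution.neg (hX : IsSolution W μ σ X P) :
    IsSolution W (fun t => -μ t) (fun t => -σ t) (fun t ω => -X t ω) P where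
  aemeasurable_zero := hX.aemeasurable_zero.neg
  indep_zero := hX.indep_zero.comp measurable_neg measurable_id
  eq_integral := by
    obtain ⟨M, hM, h⟩ := hX.eq_integral
    refine ⟨_, hM.neg, h.mono fun ω h t => ?_⟩
    rw [h t, intervalIntegral.integral_neg]
    ring

lemma IsSolution.ae_continuous (hX : IsSolution W μ σ X P) (hμ : Continuous μ) :
    ∀ᵐ ω ∂P, Continuous fun t => X t ω := by
  obtain ⟨M, hM, h⟩ := hX.eq_integral
  filter_upwards [h, hM.cont] with ω h hc
  rw [show (fun t => X t ω) = _ from funext h]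
  have h1 : Continuous fun x : ℝ => ∫ s in (0 : ℝ)..x, μ s.toNNReal :=
    intervalIntegral.continuous_primitive
      (fun a b => (hμ.comp continuous_real_toNNReal).intervalIntegrable a b) 0
  exact (continuous_const.add (h1.comp NNReal.continuous_coe)).add hc

lemma IsSolution.aemeasurable (hX : IsSolution W μ σ X P) (t : ℝ≥0) : AEMeasurable (X t) P := by
  obtain ⟨M, hM, h⟩ := hX.eq_integral
  have h1 : AEMeasurable (fun ω => X 0 ω + (∫ s in (0 : ℝ)..t, μ s.toNNReal) + M t ω) P :=
    (hX.aemeasurable_zero.add_const _).add (hM.memLp t).1.aemeasurable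
  exact h1.congr (h.mono fun ω h => (h t).symm)

/-- Almost surely, a solution that has hit a boundary is strictly below it at some time before any
later time. Otherwise the solution touches the boundary from above, at a positive time or at time
`0`; the former is excluded as the infimum of `X - γ` has no atom at `0`, the latter as the
martingale part decreases faster than linearly at time `0`, whereas `γ` does not. -/
lemma IsSolution.ae_exists_lt [IsProbabilityMeasure P] (hW : IsBrownianMotion W P)
    (hX : IsSolution W μ σ X P) (hμ : Continuous μ) (hσ : Continuous σ) {κ K : ℝ} (hκ : 0 < κ)
    (hlow : ∀ t, κ ≤ ‖σ t‖) (hup : ∀ t, ‖σ t‖ ≤ K) (hμK : ∀ t, |μ t| ≤ K) {T : ℝ≥0}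
    {γ : ℝ≥0 → ℝ} (hγ : ContinuousOn γ (Set.Ico 0 T))
    (hγ0 : ∀ S < T, ∃ L : ℝ, ∀ t ≤ S, γ 0 - L * t ≤ γ t) :
    ∀ᵐ ω ∂P, ∀ s < T, lowerHittingTime γ X T ω < s → ∃ t ≤ s, X t ω < γ t := by
  obtain ⟨M, hM, hXM⟩ := hX.eq_integral
  obtain ⟨S, hSc, hSd⟩ := TopologicalSpace.exists_countable_dense ℝ≥0
  have hatom : ∀ᵐ ω ∂P, ∀ δ ∈ S, ∀ q ∈ S, 0 < δ → δ ≤ q →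
      ¬ ((∀ t ∈ (fun t => max δ (min t q)) '' S, 0 ≤ X 0 ω + M t ω -
          (γ t - ∫ s in (0 : ℝ)..t, μ s.toNNReal)) ∧
        ∀ k : ℕ, ∃ t ∈ (fun t => max δ (min t q)) '' S, X 0 ω + M t ω -
          (γ t - ∫ s in (0 : ℝ)..t, μ s.toNNReal) < 1 / ((k : ℝ) + 1)) := by
    refine (ae_ball_iff hSc).2 fun δ _ => (ae_ball_iff hSc).2 fun q _ => ?_
    by_cases h : 0 < δ ∧ δ ≤ q
    · filter_upwards [measure_inf_eq_zero hW hσ hM hκ hlow hX.aemeasurable_zero hX.indep_zero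
        (fun t => γ t - ∫ s in (0 : ℝ)..t, μ s.toNNReal) h.1
        (hSc.image fun t => max δ (min t q)) (by
          rintro _ ⟨t, _, rfl⟩
          exact le_max_left _ _)] with ω hω _ _
      exact hω
    · exact ae_of_all _ fun ω h1 h2 => absurd ⟨h1, h2⟩ h
  have hzero : ∀ᵐ ω ∂P, ∀ c : ℕ, ∀ δ > 0, ∃ t : ℝ≥0, 0 < t ∧ t < δ ∧ M t ω < -(c : ℝ) * t :=
    ae_all_iff.2 fun c => ae_exists_lt_neg_mul hW hσ hM hκ hlow hup c
  filter_upwards [hatom, hzero, hXM, hX.ae_continuous hμ] with ω h1 h2 h3 h4 s hsT hs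
  by_contra! hcon
  obtain ⟨q, hqS, hq1, hq2⟩ := hSd.exists_between hs
  have hqT : q < T := hq2.trans hsT
  -- the boundary is touched at some time `t₀ ≤ q`
  obtain ⟨t₀, ht₀q, ht₀⟩ : ∃ t ≤ q, X t ω ≤ γ t := by
    by_contra! h
    exact absurd (lt_lowerHittingTime hγ h4 hqT h) (not_lt.2 hq1.le)
  rcases eq_or_ne t₀ 0 with h0 | h0
  · subst h0
    obtain ⟨L, hL⟩ := hγ0 q hqT
    obtain ⟨c, hc⟩ := exists_nat_ge (K + L)
    obtain ⟨t, ht0, htq, ht⟩ := h2 c q (pos_of_gt hq1)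
    have h5 := hcon t (htq.trans hq2).le
    have h6 := hL t htq.le
    rw [h3 t] at h5
    have h7 : ∫ s in (0 : ℝ)..t, μ s.toNNReal ≤ K * t := by
      have := intervalIntegral.norm_integral_le_of_norm_le_const (a := (0 : ℝ)) (b := t)
        (f := fun s => μ s.toNNReal) (C := K) fun x _ => hμK _
      rw [sub_zero, abs_of_nonneg (NNReal.coe_nonneg t)] at this
      exact (le_abs_self _).trans this
    have h8 : (0 : ℝ) < t := ht0
    nlinarith
  · obtain ⟨δ, hδS, hδ0, hδ⟩ := hSd.exists_between (pos_iff_ne_zero.2 h0)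
    refine h1 δ hδS q hqS hδ0 (hδ.le.trans ht₀q) ⟨?_, fun k => ?_⟩
    · rintro _ ⟨t, -, rfl⟩
      have h5 := hcon (max δ (min t q))
        ((max_le (hδ.le.trans ht₀q) (min_le_right _ _)).trans hq2.le)
      rw [h3] at h5
      dsimp only
      linarith
    · have hc : Continuous fun t => X (max δ (min t q)) ω - γ (max δ (min t q)) := by
        have hcl : Continuous fun t : ℝ≥0 => max δ (min t q) := by fun_prop
        refine (h4.comp hcl).sub (hγ.comp_continuous hcl fun t => ?_)
        exact ⟨zero_le, (max_le (hδ.le.trans ht₀q) (min_le_right _ _)).trans_lt hqT⟩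
      have hval : X (max δ (min t₀ q)) ω - γ (max δ (min t₀ q)) < 1 / ((k : ℝ) + 1) := by
        rw [min_eq_left ht₀q, max_eq_right hδ.le]
        have : (0 : ℝ) < 1 / ((k : ℝ) + 1) := by positivity
        linarith
      obtain ⟨u, huS, hu⟩ := hSd.exists_mem_open (isOpen_Iio.preimage hc) ⟨t₀, hval⟩
      refine ⟨_, ⟨u, huS, rfl⟩, ?_⟩
      have hu' : X (max δ (min u q)) ω - γ (max δ (min u q)) < 1 / ((k : ℝ) + 1) := hu
      rw [h3] at hu'
      dsimp only
      linarith

end Solutions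

section Convergence

/-- Uniform convergence in probability yields almost sure uniform convergence along a
subsequence. -/
lemma exists_seq_tendstoUniformlyOn {Ω : Type*} [MeasurableSpace Ω] {P : Measure Ω}
    {T : ℝ≥0} {X : ℕ → ℝ≥0 → Ω → ℝ} {X' : ℝ≥0 → Ω → ℝ}
    (h : ∀ ε > 0, Tendsto (fun n => P {ω | ∃ t ≤ T, ε < |X n t ω - X' t ω|}) atTop (𝓝 0)) :
    ∃ ns : ℕ → ℕ, StrictMono ns ∧ ∀ᵐ ω ∂P, TendstoUniformlyOn (fun k t => X (ns k) t ω)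
      (fun t => X' t ω) atTop (Set.Iic T) := by
  -- the truncation by `1` makes the supremum real-valued
  let D : ℕ → Ω → ℝ := fun n ω => (min 1 (⨆ t : Set.Iic T, edist (X n t ω) (X' t ω))).toReal
  have hD : TendstoInMeasure P D atTop (fun _ => 0) := by
    rw [tendstoInMeasure_iff_norm]
    intro ε hε
    refine tendsto_of_tendsto_of_tendsto_of_le_of_le tendsto_const_nhds (h (ε / 2) (half_pos hε))
      (fun _ => zero_le) fun n => measure_mono fun ω hω => ?_
    by_contra! hcon
    have hcon' : ∀ t ≤ T, |X n t ω - X' t ω| ≤ ε / 2 := fun t ht =>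
      not_lt.1 fun h => hcon ⟨t, ht, h⟩
    have h1 : (⨆ t : Set.Iic T, edist (X n t ω) (X' t ω)) ≤ ENNReal.ofReal (ε / 2) := by
      refine iSup_le fun t => ?_
      rw [edist_dist, Real.dist_eq]
      exact ENNReal.ofReal_le_ofReal (hcon' t t.2)
    have h2 : D n ω ≤ ε / 2 := ENNReal.toReal_le_of_le_ofReal (half_pos hε).le
      ((min_le_right _ _).trans h1)
    have h3 : ε ≤ ‖D n ω - 0‖ := hω
    rw [sub_zero, Real.norm_of_nonneg ENNReal.toReal_nonneg] at h3
    linarith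
  obtain ⟨ns, hns, hae⟩ := hD.exists_seq_tendsto_ae
  refine ⟨ns, hns, hae.mono fun ω hω => Metric.tendstoUniformlyOn_iff.2 fun ε hε => ?_⟩
  filter_upwards [hω.eventually_lt_const (lt_min hε one_pos)] with k hk t ht
  have hle : min 1 (edist (X (ns k) t ω) (X' t ω)) ≤
      min 1 (⨆ t : Set.Iic T, edist (X (ns k) t ω) (X' t ω)) :=
    min_le_min_left _ (le_iSup (fun t : Set.Iic T => edist (X (ns k) t ω) (X' t ω)) ⟨t, ht⟩)
  have h1 := (ENNReal.toReal_mono (ne_top_of_le_ne_top ENNReal.one_ne_top (min_le_left _ _))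
    hle).trans_lt hk
  rw [ENNReal.toReal_min ENNReal.one_ne_top (edist_ne_top _ _), ENNReal.toReal_one,
    ← dist_edist] at h1
  rw [dist_comm]
  rcases min_lt_iff.1 h1 with h2 | h2
  · exact absurd h2 (not_lt.2 (min_le_right _ _))
  · exact h2.trans_le (min_le_left _ _)

variable {Ω : Type*} [MeasurableSpace Ω] {P : Measure Ω} [IsProbabilityMeasure P] {d : ℕ}
  {W : ℝ≥0 → Ω → EuclideanSpace ℝ (Fin d)}

/-- If the coefficients converge pointwise on `[0, T)` and the initial values in probability, then
the solutions converge uniformly on `[0, T]`, in probability. -/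
lemma tendsto_measure_exists_lt_abs_sub (hW : IsBrownianMotion W P) {T : ℝ≥0}
    {μ : ℕ → ℝ≥0 → ℝ} {μ' : ℝ≥0 → ℝ} {σ : ℕ → ℝ≥0 → EuclideanSpace ℝ (Fin d)}
    {σ' : ℝ≥0 → EuclideanSpace ℝ (Fin d)} {X : ℕ → ℝ≥0 → Ω → ℝ} {X' : ℝ≥0 → Ω → ℝ} {K : ℝ}
    (hμ : ∀ n, Continuous (μ n)) (hμ' : Continuous μ') (hσ : ∀ n, Continuous (σ n))
    (hσ' : Continuous σ') (hμK : ∀ n t, |μ n t| ≤ K) (hμK' : ∀ t, |μ' t| ≤ K)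
    (hσK : ∀ n t, ‖σ n t‖ ≤ K) (hσK' : ∀ t, ‖σ' t‖ ≤ K)
    (hX : ∀ n, IsSolution W (μ n) (σ n) (X n) P) (hX' : IsSolution W μ' σ' X' P)
    (hX₀ : TendstoInMeasure P (fun n => X n 0) atTop (X' 0))
    (hμ_lim : ∀ t ∈ Set.Ico 0 T, Tendsto (fun n => μ n t) atTop (𝓝 (μ' t)))
    (hσ_lim : ∀ t ∈ Set.Ico 0 T, Tendsto (fun n => σ n t) atTop (𝓝 (σ' t))) {ε : ℝ} (hε : 0 < ε) :
    Tendsto (fun n => P {ω | ∃ t ≤ T, ε < |X n t ω - X' t ω|}) atTop (𝓝 0) := by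
  choose M hM hXM using fun n => (hX n).eq_integral
  obtain ⟨M', hM', hXM'⟩ := hX'.eq_integral
  have hae : ∀ᵐ s ∂volume.restrict (Set.Ioc (0 : ℝ) T), s.toNNReal ∈ Set.Ico 0 T := by
    have hne : ∀ᵐ s ∂volume.restrict (Set.Ioc (0 : ℝ) T), s ≠ (T : ℝ) :=
      compl_mem_ae_iff.2 (measure_singleton _)
    filter_upwards [ae_restrict_mem measurableSet_Ioc, hne] with s hs hsT
    refine ⟨zero_le, ?_⟩
    rw [Real.toNNReal_lt_iff_lt_coe hs.1.le]
    exact lt_of_le_of_ne hs.2 hsT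
  -- the drifts converge
  have hdrift : Tendsto (fun n => ∫ s in Set.Ioc (0 : ℝ) T, |μ n s.toNNReal - μ' s.toNNReal|) atTop
      (𝓝 0) := by
    have := tendsto_integral_of_dominated_convergence (μ := volume.restrict (Set.Ioc (0 : ℝ) T))
      (F := fun n s => |μ n s.toNNReal - μ' s.toNNReal|) (f := fun _ => 0) (fun _ => K + K)
      (fun n => (((hμ n).comp continuous_real_toNNReal).sub
        (hμ'.comp continuous_real_toNNReal)).abs.aestronglyMeasurable)
      (by simp) (fun n => ae_of_all _ fun s => ?_) ?_
    · simpa using this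
    · rw [Real.norm_eq_abs, abs_abs]
      exact (abs_sub _ _).trans (add_le_add (hμK _ _) (hμK' _))
    · filter_upwards [hae] with s hs
      simpa using ((hμ_lim _ hs).sub_const (μ' s.toNNReal)).abs
  -- the diffusion coefficients converge
  have hdiff : Tendsto (fun n => ∫ s in Set.Ioc (0 : ℝ) T, ‖σ n s.toNNReal - σ' s.toNNReal‖ ^ 2)
      atTop (𝓝 0) := by
    have := tendsto_integral_of_dominated_convergence (μ := volume.restrict (Set.Ioc (0 : ℝ) T))
      (F := fun n s => ‖σ n s.toNNReal - σ' s.toNNReal‖ ^ 2) (f := fun _ => 0)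
      (fun _ => (K + K) ^ 2)
      (fun n => ((((hσ n).comp continuous_real_toNNReal).sub
        (hσ'.comp continuous_real_toNNReal)).norm.pow 2).aestronglyMeasurable)
      (by simp) (fun n => ae_of_all _ fun s => ?_) ?_
    · simpa using this
    · rw [Real.norm_eq_abs, abs_of_nonneg (sq_nonneg _)]
      exact pow_le_pow_left₀ (norm_nonneg _)
        ((norm_sub_le _ _).trans (add_le_add (hσK _ _) (hσK' _))) 2
    · filter_upwards [hae] with s hs
      simpa using ((hσ_lim _ hs).sub_const (σ' s.toNNReal)).norm.pow 2
  have hmart (n : ℕ) : P {ω | ∃ t ≤ T, ε / 3 < |M n t ω - M' t ω|} ≤ ENNReal.ofReal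
      ((∫ s in Set.Ioc (0 : ℝ) T, ‖σ n s.toNNReal - σ' s.toNNReal‖ ^ 2) / (ε / 3) ^ 2) := by
    refine measure_exists_lt_abs_le hW (N := fun t => M n t - M' t)
      (ρ := fun s => σ n s.toNNReal - σ' s.toNNReal) (fun t => ?_) ?_ T (by positivity)
    · have := ((hM n).isWienerIntegral hW (hσ n) t).sub (hM'.isWienerIntegral hW hσ' t)
      rwa [← Set.indicator_sub'] at this
    · filter_upwards [(hM n).cont, hM'.cont] with ω h h'
      exact h.sub h'
  have hlim : Tendsto (fun n => P {ω | ε / 3 ≤ ‖X n 0 ω - X' 0 ω‖} + ENNReal.ofReal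
      ((∫ s in Set.Ioc (0 : ℝ) T, ‖σ n s.toNNReal - σ' s.toNNReal‖ ^ 2) / (ε / 3) ^ 2)) atTop
      (𝓝 0) := by
    have h1 := tendstoInMeasure_iff_norm.1 hX₀ (ε / 3) (by positivity)
    have h2 := ENNReal.tendsto_ofReal (hdiff.div_const ((ε / 3) ^ 2))
    simpa using h1.add h2
  refine tendsto_of_tendsto_of_tendsto_of_le_of_le' tendsto_const_nhds hlim
    (Eventually.of_forall fun _ => zero_le) ?_
  filter_upwards [hdrift.eventually_le_const (show 0 < ε / 3 by positivity)] with n hn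
  refine le_trans (measure_mono_ae ?_) ((measure_union_le _ _).trans
    (add_le_add le_rfl (hmart n)))
  filter_upwards [hXM n, hXM'] with ω h1 h2
  rintro ⟨t, htT, ht⟩
  by_contra! hcon
  have hc1 : ‖X n 0 ω - X' 0 ω‖ < ε / 3 := not_le.1 fun h => hcon (Or.inl h)
  have hc2 : |M n t ω - M' t ω| ≤ ε / 3 := not_lt.1 fun h => hcon (Or.inr ⟨t, htT, h⟩)
  have hc (μ : ℝ≥0 → ℝ) (hμ : Continuous μ) :
      IntervalIntegrable (fun s : ℝ => μ s.toNNReal) volume 0 t :=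
    (hμ.comp continuous_real_toNNReal).intervalIntegrable _ _
  have hc3 : |(∫ s in (0 : ℝ)..t, μ n s.toNNReal) - ∫ s in (0 : ℝ)..t, μ' s.toNNReal| ≤ ε / 3 := by
    rw [← intervalIntegral.integral_sub (hc _ (hμ n)) (hc _ hμ')]
    refine (intervalIntegral.abs_integral_le_integral_abs (NNReal.coe_nonneg t)).trans
      (le_trans ?_ hn)
    rw [intervalIntegral.integral_of_le (NNReal.coe_nonneg t)]
    refine setIntegral_mono_set ?_ (ae_of_all _ fun s => abs_nonneg _)
      (Set.Ioc_subset_Ioc_right (NNReal.coe_le_coe.2 htT)).eventuallyLE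
    exact (((hμ n).comp continuous_real_toNNReal).sub
        (hμ'.comp continuous_real_toNNReal)).abs.integrableOn_Ioc
  rw [h1 t, h2 t] at ht
  rw [Real.norm_eq_abs] at hc1
  have hc1' := abs_lt.1 hc1
  have hc2' := abs_le.1 hc2
  have hc3' := abs_le.1 hc3
  rcases lt_abs.1 ht with h | h <;> linarith

/-- Convergence in probability of the hitting times of lower boundaries. Of the regularity of the
boundaries only continuity and the linear lower bound `hγ0` for the limit at time `0` are needed. -/
theorem tendstoInMeasure_lowerHittingTime (hW : IsBrownianMotion W P) {T : ℝ≥0}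
    {μ : ℕ → ℝ≥0 → ℝ} {μ' : ℝ≥0 → ℝ} {σ : ℕ → ℝ≥0 → EuclideanSpace ℝ (Fin d)}
    {σ' : ℝ≥0 → EuclideanSpace ℝ (Fin d)} {X : ℕ → ℝ≥0 → Ω → ℝ} {X' : ℝ≥0 → Ω → ℝ} {κ K : ℝ}
    {γ : ℕ → ℝ≥0 → ℝ} {γ' : ℝ≥0 → ℝ}
    (hμ : ∀ n, Continuous (μ n)) (hμ' : Continuous μ') (hσ : ∀ n, Continuous (σ n))
    (hσ' : Continuous σ') (hμK : ∀ n t, |μ n t| ≤ K) (hμK' : ∀ t, |μ' t| ≤ K)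
    (hκ : 0 < κ) (hσκ' : ∀ t, κ ≤ ‖σ' t‖)
    (hσK : ∀ n t, ‖σ n t‖ ≤ K) (hσK' : ∀ t, ‖σ' t‖ ≤ K)
    (hX : ∀ n, IsSolution W (μ n) (σ n) (X n) P) (hX' : IsSolution W μ' σ' X' P)
    (hX₀ : TendstoInMeasure P (fun n => X n 0) atTop (X' 0))
    (hμ_lim : ∀ t ∈ Set.Ico 0 T, Tendsto (fun n => μ n t) atTop (𝓝 (μ' t)))
    (hσ_lim : ∀ t ∈ Set.Ico 0 T, Tendsto (fun n => σ n t) atTop (𝓝 (σ' t)))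
    (hγ_lim : TendstoLocallyUniformlyOn γ γ' atTop (Set.Ico 0 T))
    (hγ : ∀ n, ContinuousOn (γ n) (Set.Ico 0 T)) (hγ' : ContinuousOn γ' (Set.Ico 0 T))
    (hγ0 : ∀ S < T, ∃ L : ℝ, ∀ t ≤ S, γ' 0 - L * t ≤ γ' t) :
    TendstoInMeasure P (fun n => lowerHittingTime (γ n) (X n) T) atTop
      (lowerHittingTime γ' X' T) := by
  refine (exists_seq_tendstoInMeasure_atTop_iff fun n => (aemeasurable_lowerHittingTime (hγ n)
    ((hX n).ae_continuous (hμ n)) (hX n).aemeasurable).aestronglyMeasurable).2 fun ns hns => ?_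
  obtain ⟨ns', hns', hae⟩ := exists_seq_tendstoUniformlyOn fun ε hε =>
    (tendsto_measure_exists_lt_abs_sub hW hμ hμ' hσ hσ' hμK hμK' hσK hσK' hX hX' hX₀ hμ_lim hσ_lim
      hε).comp hns.tendsto_atTop
  refine ⟨ns', hns', ?_⟩
  filter_upwards [hae, hX'.ae_continuous hμ',
    hX'.ae_exists_lt hW hμ' hσ' hκ hσκ' hσK' hμK' hγ' hγ0] with ω h1 h2 h3
  refine tendsto_lowerHittingTime hγ' h2
    (γ' := fun i => γ (ns (ns' i))) (X' := fun i => X (ns (ns' i))) ?_ h1 h3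
  intro u hu x hx
  obtain ⟨t, ht, h⟩ := hγ_lim u hu x hx
  exact ⟨t, ht, (hns.tendsto_atTop.comp hns'.tendsto_atTop).eventually h⟩

end Convergence

theorem lemmaF1 {Ω : Type*} [MeasurableSpace Ω] (P : Measure Ω) [IsProbabilityMeasure P]
    {d : ℕ} (W : ℝ≥0 → Ω → EuclideanSpace ℝ (Fin d)) (hW : IsBrownianMotion W P)
    (T : ℝ≥0) (hT : 0 < T)
    -- the index `⊤ : ℕ∞` stands for the limiting objects
    (μ : ℕ∞ → ℝ≥0 → ℝ) (σ : ℕ∞ → ℝ≥0 → EuclideanSpace ℝ (Fin d))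
    (X : ℕ∞ → ℝ≥0 → Ω → ℝ) (γ Γ : ℕ∞ → ℝ≥0 → ℝ)
    (hμ : ∀ n, Continuous (μ n)) (hσ : ∀ n, Continuous (σ n))
    (κ K : ℝ) (hκ : 0 < κ)
    (hσ_lower : ∀ n t, κ ≤ ‖σ n t‖) (hσ_upper : ∀ n t, ‖σ n t‖ ≤ K)
    (hμ_bound : ∀ n t, |μ n t| ≤ K)
    (hX : ∀ n, IsSolution W (μ n) (σ n) (X n) P)
    -- convergence of the boundaries
    (hγ_lim : TendstoLocallyUniformlyOn (fun n : ℕ => γ n) (γ ⊤) atTop (Set.Ico 0 T))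
    (hΓ_lim : TendstoLocallyUniformlyOn (fun n : ℕ => Γ n) (Γ ⊤) atTop (Set.Ico 0 T))
    -- convergence of initial values and coefficients
    (hX₀_lim : TendstoInMeasure P (fun n : ℕ => X n 0) atTop (X ⊤ 0))
    (hμ_lim : ∀ t ∈ Set.Ico 0 T, Tendsto (fun n : ℕ => μ n t) atTop (𝓝 (μ ⊤ t)))
    (hσ_lim : ∀ t ∈ Set.Ico 0 T, Tendsto (fun n : ℕ => σ n t) atTop (𝓝 (σ ⊤ t)))
    -- regularity of the lower boundaries
    (hγ_reg : (∀ n, MonotoneOn (γ n) (Set.Ico 0 T) ∧ ContinuousOn (γ n) (Set.Ico 0 T)) ∨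
      UniformlyLocallyLipschitz γ T)
    -- regularity of the upper boundaries
    (hΓ_reg : (∀ n, AntitoneOn (Γ n) (Set.Ico 0 T) ∧ ContinuousOn (Γ n) (Set.Ico 0 T)) ∨
      UniformlyLocallyLipschitz Γ T) :
    TendstoInMeasure P (fun n : ℕ => lowerHittingTime (γ n) (X n) T) atTop
        (lowerHittingTime (γ ⊤) (X ⊤) T) ∧
      TendstoInMeasure P (fun n : ℕ => upperHittingTime (Γ n) (X n) T) atTop
        (upperHittingTime (Γ ⊤) (X ⊤) T) := by
  -- either kind of regularity gives continuity and an at most linear decrease from time `0`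
  have hreg (g : ℕ∞ → ℝ≥0 → ℝ)
      (h : (∀ n, MonotoneOn (g n) (Set.Ico 0 T) ∧ ContinuousOn (g n) (Set.Ico 0 T)) ∨
        UniformlyLocallyLipschitz g T) :
      (∀ n, ContinuousOn (g n) (Set.Ico 0 T)) ∧
        ∀ S < T, ∃ L : ℝ, ∀ t ≤ S, g ⊤ 0 - L * t ≤ g ⊤ t := by
    rcases h with h | h
    · refine ⟨fun n => (h n).2, fun S hS => ⟨0, fun t ht => ?_⟩⟩
      have := (h ⊤).1 ⟨le_rfl, hT⟩ ⟨zero_le, ht.trans_lt hS⟩ (zero_le (a := t))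
      simpa using this
    · refine ⟨fun n t ht => ?_, fun S hS => ?_⟩
      · obtain ⟨S, htS, hST⟩ := exists_between ht.2
        obtain ⟨L, hL⟩ := h S hST
        refine ((hL n).continuousOn t ⟨ht.1, htS.le⟩).mono_of_mem_nhdsWithin ?_
        refine mem_nhdsWithin_of_mem_nhds ?_
        filter_upwards [Iio_mem_nhds htS] with s hs
        exact ⟨zero_le, le_of_lt hs⟩
      · obtain ⟨L, hL⟩ := h S hS
        refine ⟨L, fun t ht => ?_⟩
        have h1 := (hL ⊤).dist_le_mul t ⟨zero_le, ht⟩ 0 ⟨le_rfl, zero_le⟩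
        rw [Real.dist_eq, NNReal.dist_eq, NNReal.coe_zero, sub_zero,
          abs_of_nonneg (NNReal.coe_nonneg t)] at h1
        linarith [(abs_le.1 h1).1]
  have hneg (Γ : ℝ≥0 → ℝ) (X : ℝ≥0 → Ω → ℝ) : upperHittingTime Γ X T =
      lowerHittingTime (fun t => -Γ t) (fun t ω => -X t ω) T := by
    unfold upperHittingTime lowerHittingTime
    congr 1
    ext t ω
    ring
  constructor
  · obtain ⟨h1, h2⟩ := hreg γ hγ_reg
    exact tendstoInMeasure_lowerHittingTime hW (fun n => hμ n) (hμ ⊤) (fun n => hσ n) (hσ ⊤)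
      (fun n => hμ_bound n) (hμ_bound ⊤) hκ (hσ_lower ⊤) (fun n => hσ_upper n) (hσ_upper ⊤)
      (fun n => hX n) (hX ⊤) hX₀_lim hμ_lim hσ_lim hγ_lim (fun n => h1 n) (h1 ⊤) h2
  · obtain ⟨h1, h2⟩ := hreg (fun n t => -Γ n t) (hΓ_reg.imp
      (fun h n => ⟨(h n).1.neg, (h n).2.neg⟩) fun h S hS => (h S hS).imp fun L hL n => (hL n).neg)
    simp_rw [hneg]
    refine tendstoInMeasure_lowerHittingTime hW (fun n => (hμ n).neg) (hμ ⊤).neg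
      (fun n => (hσ n).neg) (hσ ⊤).neg (fun n t => by simpa using hμ_bound n t)
      (fun t => by simpa using hμ_bound ⊤ t) hκ (fun t => by simpa using hσ_lower ⊤ t)
      (fun n t => by simpa using hσ_upper n t) (fun t => by simpa using hσ_upper ⊤ t)
      (fun n => (hX n).neg) (hX ⊤).neg ?_ (fun t ht => (hμ_lim t ht).neg)
      (fun t ht => (hσ_lim t ht).neg) ?_ (fun n => h1 n) (h1 ⊤) h2
    · refine fun ε hε => (hX₀_lim ε hε).congr fun n => ?_
      simp_rw [edist_neg_neg]
    · rw [Metric.tendstoLocallyUniformlyOn_iff] at hΓ_lim ⊢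
      simpa only [dist_neg_neg] using hΓ_lim
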